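/- Let $N\ge 1$, let $\Omega\subset\mathbb R^N$ be a nonempty bounded open set (for instance a bounded Lipschitz domain; no regularity of $\partial\Omega$ and no connectedness is assumed), let $s\in(0,1)$, and let $p\in C(\mathbb R^N\times\mathbb R^N)$ be symmetric, $p(x,y)=p(y,x)$, with $$1<\inf_{\mathbb R^N\times\mathbb R^N}p\le\sup_{\mathbb R^N\times\mathbb R^N}p<\frac Ns .$$ Put $\bar p(x)=p(x,x)$. For measurable $u:\mathbb R^N\to\mathbb R$ (functions equal almost everywhere being identified) let $$\|u\|_{\bar p,\Omega}=\inf\Big\{\lambda>0:\ \int_\Omega\Big|\frac{u(x)}{\lambda}\Big|^{\bar p(x)}\frac{dx}{\bar p(x)}\le1\Big\},$$ $$[u]_{s,p(\cdot,\cdot)}=\inf\Big\{\lambda>0:\ \int_{\mathbb R^N}\int_{\mathbb R^N}\frac{|u(x)-u(y)|^{p(x,y)}}{\lambda^{p(x,y)}|x-y|^{N+sp(x,y)}}\,\frac{dx\,dy}{p(x,y)}<1\Big\}.$$ Let $X$ be the space of all measurable $u:\mathbb R^N\to\mathbb R$ with $u=0$ a.e. on $\mathbb R^N\setminus\Omega$,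 $$\int_{\mathbb R^N}|u(x)|^{\bar p(x)}dx<\infty\quad\text{and}\quad \int_{\mathbb R^N}\int_{\mathbb R^N}\frac{|u(x)-u(y)|^{p(x,y)}}{|x-y|^{N+sp(x,y)}}\,dx\,dy<\infty ,$$ and set $$\Lambda_1=\inf_{v\in X\setminus\{0\}}\frac{[v]_{s,p(\cdot,\cdot)}}{\|v\|_{\bar p,\Omega}} .$$ Then $\Lambda_1>0$, and there is $u\in X\setminus\{0\}$ with $u\ge0$ almost everywhere and $$\frac{[u]_{s,p(\cdot,\cdot)}}{\|u\|_{\bar p,\Omega}}=\Lambda_1 .$$ -/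

import Mathlib

open MeasureTheory
open scoped ENNReal

namespace FracVarExp

noncomputable section

/-- The Euclidean space `ℝ^N`. -/
abbrev Euc (N : ℕ) : Type := EuclideanSpace ℝ (Fin N)

/-- The Lebesgue modular `∫_Ω |u(x)|^{r(x)} dx / r(x)`. -/
def lebesgueModular {N : ℕ} (Ω : Set (Euc N)) (r : Euc N → ℝ) (u : Euc N → ℝ) : ℝ≥0∞ :=
  ∫⁻ x in Ω, ENNReal.ofReal (|u x| ^ r x / r x)

/-- The Luxemburg norm `‖u‖_{r,Ω} = inf {λ > 0 : ∫_Ω |u/λ|^{r(x)} dx / r(x) ≤ 1}`. -/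
def luxNorm {N : ℕ} (Ω : Set (Euc N)) (r : Euc N → ℝ) (u : Euc N → ℝ) : ℝ :=
  sInf {c : ℝ | 0 < c ∧ lebesgueModular Ω r (fun x => u x / c) ≤ 1}

/-- The fractional modular
`∫∫ |u(x) - u(y)|^{p(x,y)} / |x - y|^{N + s p(x,y)} dx dy / p(x,y)` over `ℝ^N × ℝ^N`. -/
def fracModular {N : ℕ} (s : ℝ) (p : Euc N → Euc N → ℝ) (u : Euc N → ℝ) : ℝ≥0∞ :=
  ∫⁻ x, ∫⁻ y, ENNReal.ofReal
    (|u x - u y| ^ p x y / ‖x - y‖ ^ ((N : ℝ) + s * p x y) / p x y)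

/-- The Luxemburg seminorm
`[u]_{s,p(·,·)} = inf {λ > 0 : fracModular (u/λ) < 1}` over `ℝ^N`. -/
def fracSeminorm {N : ℕ} (s : ℝ) (p : Euc N → Euc N → ℝ) (u : Euc N → ℝ) : ℝ :=
  sInf {c : ℝ | 0 < c ∧ fracModular s p (fun x => u x / c) < 1}

/-- The fractional Sobolev space with variable exponent on `ℝ^N`: (classes of) measurable
functions `u` with `∫ |u(x)|^{p(x,x)} dx < ∞` and
`∫∫ |u(x) - u(y)|^{p(x,y)} / |x - y|^{N + s p(x,y)} dx dy < ∞`. -/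
def fracSobolev {N : ℕ} (s : ℝ) (p : Euc N → Euc N → ℝ) :
    Set (Euc N →ₘ[(volume : Measure (Euc N))] ℝ) :=
  {u | ∫⁻ x, ENNReal.ofReal (|u x| ^ p x x) < ⊤ ∧
    ∫⁻ x, ∫⁻ y, ENNReal.ofReal
      (|u x - u y| ^ p x y / ‖x - y‖ ^ ((N : ℝ) + s * p x y)) < ⊤}

/-- The space `X` of those elements of the fractional Sobolev space on `ℝ^N` that vanish
(almost everywhere) outside `Ω`. -/
def X {N : ℕ} (Ω : Set (Euc N)) (s : ℝ) (p : Euc N → Euc N → ℝ) :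
    Set (Euc N →ₘ[(volume : Measure (Euc N))] ℝ) :=
  {u | u ∈ fracSobolev s p ∧ ∀ᵐ x ∂(volume : Measure (Euc N)), x ∉ Ω → u x = 0}

/-- The homogeneous Rayleigh quotient `H_s(u) = [u]_{s,p(·,·)} / ‖u‖_{p̄,Ω}` with
`p̄(x) = p(x,x)`. -/
def rayleigh {N : ℕ} (Ω : Set (Euc N)) (s : ℝ) (p : Euc N → Euc N → ℝ)
    (u : Euc N →ₘ[(volume : Measure (Euc N))] ℝ) : ℝ :=
  fracSeminorm s p u / luxNorm Ω (fun x => p x x) u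

/-- `Λ₁`, the infimum of the homogeneous Rayleigh quotient over `X \ {0}`. -/
def Lambda1 {N : ℕ} (Ω : Set (Euc N)) (s : ℝ) (p : Euc N → Euc N → ℝ) : ℝ :=
  sInf (rayleigh Ω s p '' (X Ω s p \ {0}))

end

end FracVarExp

/-! This is the direct method, with compactness obtained by hand instead of from a Sobolev
embedding. Scaling makes the Lebesgue modular equal to 1 along a minimizing sequence, with
fractional seminorms below constants tending to `Λ₁`; this bounds the energies. Vanishing outside
the bounded set gives an `L¹` bound (`exists_lintegral_enorm_le`). Mean oscillation over small cubes
is controlled by the energy, so finitely many cell integrals determine a function in `L¹` up to a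
small error; hence a subsequence converges a.e. (`exists_subseq_tendsto_ae`). Fatou passes the
fractional modular to the limit.

The delicate point is that no Lebesgue modular escapes. If `t = |u x|` is large, the `L¹` bound
forces `|u| < t / 2` on at least half of a ball of radius `t ^ (-1/(2N))` around `x`. The singular
kernel then makes the inner energy integral at least a constant times `t ^ (p x x + δ)`, where
continuity of `p` costs one `δ` and the kernel gains `2δ` (`rpow_le_lintegral_gagliardo`). This
surplus power is uniform integrability, so the limit still has modular 1.

Taking absolute values does not increase the fractional modular, so the minimizer may be taken
nonnegative. If `Λ₁ = 0`, every multiple of the limit would have bounded energy and hence bounded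
`L¹` norm, forcing the limit to vanish. -/

namespace FracVarExp

open Filter Topology Set

/-! ### Luxemburg norms from two-sided scaling of a modular. -/

section Luxemburg

variable {φ : ℝ → ℝ≥0∞} {a b : ℝ}

/-- The scaling behaviour of `c ↦ Φ (u / c)` for a modular `Φ` with exponents in `[a, b]`. -/
structure IsModularScaling (φ : ℝ → ℝ≥0∞) (a b : ℝ) : Prop where
  pos : 0 < a
  down : ∀ c > 0, ∀ t ≥ 1, φ (t * c) ≤ ENNReal.ofReal (t ^ (-a)) * φ c
  up : ∀ c > 0, ∀ t ≥ 1, φ c ≤ ENNReal.ofReal (t ^ b) * φ (t * c)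

namespace IsModularScaling

theorem antitone (h : IsModularScaling φ a b) {c d : ℝ} (hc : 0 < c) (hcd : c ≤ d) :
    φ d ≤ φ c := by
  have h1 : 1 ≤ d / c := (one_le_div hc).2 hcd
  have h2 := h.down c hc (d / c) h1
  rw [div_mul_cancel₀ _ hc.ne'] at h2
  refine h2.trans ?_
  have h3 : ENNReal.ofReal ((d / c) ^ (-a)) ≤ 1 :=
    ENNReal.ofReal_le_one.2 (Real.rpow_le_one_of_one_le_of_nonpos h1 (by linarith [h.pos]))
  calc _ ≤ 1 * φ c := by gcongr
    _ = φ c := one_mul _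

/-- This reconciles the two thresholds in use, `≤ 1` in `luxNorm` and `< 1` in `fracSeminorm`. -/
theorem lt_one_of_le_one (h : IsModularScaling φ a b) {c d : ℝ} (hc : 0 < c) (hcd : c < d)
    (hφ : φ c ≤ 1) : φ d < 1 := by
  have h1 : 1 < d / c := (one_lt_div hc).2 hcd
  have h2 := h.down c hc (d / c) h1.le
  rw [div_mul_cancel₀ _ hc.ne'] at h2
  refine h2.trans_lt ?_
  have h3 : ENNReal.ofReal ((d / c) ^ (-a)) < 1 := by
    rw [ENNReal.ofReal_lt_one]
    exact Real.rpow_lt_one_of_one_lt_of_neg h1 (by linarith [h.pos])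
  calc _ ≤ ENNReal.ofReal ((d / c) ^ (-a)) * 1 := by gcongr
    _ < 1 := by rwa [mul_one]

theorem exists_lt_one (h : IsModularScaling φ a b) (hfin : φ 1 ≠ ⊤) :
    ∃ c > 0, φ c < 1 := by
  have h1 : Tendsto (fun t : ℝ => ENNReal.ofReal (t ^ (-a)) * φ 1) atTop (𝓝 0) := by
    have := ENNReal.tendsto_ofReal (tendsto_rpow_neg_atTop h.pos)
    rw [ENNReal.ofReal_zero] at this
    simpa using ENNReal.Tendsto.mul_const this (Or.inr hfin)
  obtain ⟨t, ht, ht1⟩ := ((h1.eventually_lt_const one_pos).and (eventually_ge_atTop 1)).exists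
  refine ⟨t, by linarith, ?_⟩
  have := h.down 1 one_pos t ht1
  rw [mul_one] at this
  exact this.trans_lt ht

theorem ne_top (h : IsModularScaling φ a b) {c d : ℝ} (hc : 0 < c) (hd : 0 < d) (hfin : φ d ≠ ⊤) :
    φ c ≠ ⊤ := by
  rcases le_total d c with hdc | hcd
  · exact ne_top_of_le_ne_top hfin (h.antitone hd hdc)
  · have := h.up c hc (d / c) ((one_le_div hc).2 hcd)
    rw [div_mul_cancel₀ _ hc.ne'] at this
    exact ne_top_of_le_ne_top (ENNReal.mul_ne_top ENNReal.ofReal_ne_top hfin) this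

theorem bddBelow (P : ℝ → Prop) : BddBelow {c : ℝ | 0 < c ∧ P c} := ⟨0, fun _ hc => hc.1.le⟩

/-- An admissible `c ≤ 1` satisfies `φ 1 ≤ c ^ a`, so `c` cannot drop below `(φ 1) ^ (1/a)`. -/
theorem sInf_pos (h : IsModularScaling φ a b) (h0 : φ 1 ≠ 0) (hfin : φ 1 ≠ ⊤) :
    0 < sInf {c : ℝ | 0 < c ∧ φ c ≤ 1} := by
  have hpos : 0 < (φ 1).toReal := ENNReal.toReal_pos h0 hfin
  obtain ⟨c₀, hc₀, hc₀'⟩ := h.exists_lt_one hfin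
  refine lt_of_lt_of_le (lt_min one_pos (Real.rpow_pos_of_pos hpos a⁻¹))
    (le_csInf (show Set.Nonempty _ from ⟨c₀, hc₀, hc₀'.le⟩) ?_)
  rintro c ⟨hc, hc1⟩
  rcases le_total 1 c with h1 | h1
  · exact (min_le_left _ _).trans h1
  · refine (min_le_right _ _).trans ?_
    have h2 := h.down c hc (1 / c) ((one_le_div hc).2 h1)
    rw [div_mul_cancel₀ _ hc.ne'] at h2
    have h3 : φ 1 ≤ ENNReal.ofReal (c ^ a) := by
      refine h2.trans ?_
      rw [one_div, Real.inv_rpow hc.le, Real.rpow_neg hc.le, inv_inv]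
      calc _ ≤ ENNReal.ofReal (c ^ a) * 1 := by gcongr
        _ = _ := mul_one _
    have h4 : (φ 1).toReal ≤ c ^ a := ENNReal.toReal_le_of_le_ofReal (by positivity) h3
    calc (φ 1).toReal ^ a⁻¹ ≤ (c ^ a) ^ a⁻¹ := by
          apply Real.rpow_le_rpow hpos.le h4 (inv_nonneg.2 h.pos.le)
      _ = c := Real.rpow_rpow_inv hc.le h.pos.ne'

/-- Moving the argument by a factor `t` costs at most `t ^ b`. Each inequality is proved up to this
factor, at `t * L` or at `L / t`, and then `t → 1` from the right. -/
theorem apply_sInf (h : IsModularScaling φ a b) (h0 : φ 1 ≠ 0) (hfin : φ 1 ≠ ⊤) :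
    φ (sInf {c : ℝ | 0 < c ∧ φ c ≤ 1}) = 1 := by
  set L := sInf {c : ℝ | 0 < c ∧ φ c ≤ 1} with hL
  have hLpos : 0 < L := h.sInf_pos h0 hfin
  obtain ⟨c₀, hc₀, hc₀'⟩ := h.exists_lt_one hfin
  have hLfin : φ L ≠ ⊤ := h.ne_top hLpos one_pos hfin
  have hlim : Tendsto (fun t : ℝ => ENNReal.ofReal (t ^ b)) (𝓝[>] 1) (𝓝 1) := by
    have : ContinuousAt (fun t : ℝ => ENNReal.ofReal (t ^ b)) 1 :=
      ENNReal.continuous_ofReal.continuousAt.comp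
        (Real.continuousAt_rpow_const _ _ (Or.inl one_ne_zero))
    simpa [ContinuousAt] using this.tendsto.mono_left nhdsWithin_le_nhds
  apply le_antisymm
  · refine ge_of_tendsto hlim ?_
    filter_upwards [self_mem_nhdsWithin] with t (ht : 1 < t)
    have h1 : L < t * L := by nlinarith
    obtain ⟨c, ⟨hc, hc1⟩, hcL⟩ := exists_lt_of_csInf_lt (s := {c : ℝ | 0 < c ∧ φ c ≤ 1}) ⟨c₀, hc₀, hc₀'.le⟩ h1
    calc φ L ≤ ENNReal.ofReal (t ^ b) * φ (t * L) := h.up L hLpos t ht.le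
      _ ≤ ENNReal.ofReal (t ^ b) * 1 := by
          gcongr
          exact (h.antitone hc hcL.le).trans hc1
      _ = _ := mul_one _
  · have hlim2 : Tendsto (fun t : ℝ => ENNReal.ofReal (t ^ b) * φ L) (𝓝[>] 1) (𝓝 (φ L)) := by
      simpa using ENNReal.Tendsto.mul_const hlim (Or.inr hLfin)
    refine ge_of_tendsto hlim2 ?_
    filter_upwards [self_mem_nhdsWithin] with t (ht : 1 < t)
    have ht0 : 0 < t := by linarith
    have h2 := h.up (L / t) (by positivity) t ht.le
    rw [mul_div_cancel₀ _ ht0.ne'] at h2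
    refine le_trans ?_ h2
    by_contra! hcon
    have : L ≤ L / t := csInf_le (s := {c : ℝ | 0 < c ∧ φ c ≤ 1}) (bddBelow _) ⟨by positivity, hcon.le⟩
    have : L / t < L := div_lt_self hLpos ht
    linarith

theorem sInf_eq_one (h : IsModularScaling φ a b) (h1 : φ 1 = 1) :
    sInf {c : ℝ | 0 < c ∧ φ c ≤ 1} = 1 := by
  apply le_antisymm
  · exact csInf_le (s := {c : ℝ | 0 < c ∧ φ c ≤ 1}) (bddBelow _) ⟨one_pos, h1.le⟩
  · refine le_csInf ⟨1, one_pos, h1.le⟩ ?_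
    rintro c ⟨hc, hc1⟩
    by_contra! hlt
    exact (h.lt_one_of_le_one hc hlt hc1).ne h1

theorem lt_one_of_sInf_lt (h : IsModularScaling φ a b) (hfin : φ 1 ≠ ⊤) {c : ℝ}
    (hc : sInf {c : ℝ | 0 < c ∧ φ c < 1} < c) : φ c < 1 := by
  obtain ⟨c₀, hc₀, hc₀'⟩ := h.exists_lt_one hfin
  obtain ⟨d, ⟨hd, hd1⟩, hdc⟩ := exists_lt_of_csInf_lt (s := {c : ℝ | 0 < c ∧ φ c < 1}) ⟨c₀, hc₀, hc₀'⟩ hc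
  exact (h.antitone hd hdc.le).trans_lt hd1

theorem sInf_le_of_forall_le_one (h : IsModularScaling φ a b) {Λ : ℝ} (hΛ : 0 ≤ Λ)
    (hc : ∀ c > Λ, φ c ≤ 1) : sInf {c : ℝ | 0 < c ∧ φ c < 1} ≤ Λ := by
  refine le_of_forall_gt_imp_ge_of_dense fun c hcΛ => ?_
  obtain ⟨d, hd, hdc⟩ := exists_between hcΛ
  exact csInf_le (bddBelow (φ · < 1))
    ⟨hΛ.trans_lt hcΛ, h.lt_one_of_le_one (hΛ.trans_lt hd) hdc (hc d hd)⟩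

end IsModularScaling

theorem abs_div_rpow_le {v q a c t : ℝ} (hq : a ≤ q) (hc : 0 < c) (ht : 1 ≤ t) :
    |v / (t * c)| ^ q ≤ t ^ (-a) * |v / c| ^ q := by
  have ht0 : 0 < t := by linarith
  have : |v / (t * c)| = t⁻¹ * |v / c| := by
    rw [abs_div, abs_div, abs_mul, abs_of_pos ht0]; field_simp
  rw [this, Real.mul_rpow (by positivity) (by positivity), Real.inv_rpow ht0.le,
    ← Real.rpow_neg ht0.le]
  gcongr

theorem le_abs_div_rpow {v q b c t : ℝ} (hq : q ≤ b) (hc : 0 < c) (ht : 1 ≤ t) :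
    |v / c| ^ q ≤ t ^ b * |v / (t * c)| ^ q := by
  have ht0 : 0 < t := by linarith
  have : |v / c| = t * |v / (t * c)| := by
    rw [abs_div, abs_div, abs_mul, abs_of_pos ht0]; field_simp
  rw [this, Real.mul_rpow (by positivity) (by positivity)]
  gcongr

end Luxemburg

/-! ### The two modulars and the Gagliardo density. -/

section Modulars

variable {N : ℕ} {s a b : ℝ} {p : Euc N → Euc N → ℝ}

theorem lebesgueModular_scaling (Ω : Set (Euc N)) {r : Euc N → ℝ} (ha : 0 < a)
    (har : ∀ x, a ≤ r x) (hrb : ∀ x, r x ≤ b) (u : Euc N → ℝ) :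
    IsModularScaling (fun c => lebesgueModular Ω r (fun x => u x / c)) a b where
  pos := ha
  down c hc t ht := by
    have ht0 : 0 < t := by linarith
    simp only [lebesgueModular]
    rw [← lintegral_const_mul' _ _ ENNReal.ofReal_ne_top]
    refine lintegral_mono fun x => ?_
    rw [← ENNReal.ofReal_mul (by positivity), ← mul_div_assoc]
    have : 0 ≤ r x := ha.le.trans (har x)
    gcongr
    exact abs_div_rpow_le (har x) hc ht
  up c hc t ht := by
    have ht0 : 0 < t := by linarith
    simp only [lebesgueModular]
    rw [← lintegral_const_mul' _ _ ENNReal.ofReal_ne_top]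
    refine lintegral_mono fun x => ?_
    rw [← ENNReal.ofReal_mul (by positivity), ← mul_div_assoc]
    have : 0 ≤ r x := ha.le.trans (har x)
    gcongr
    exact le_abs_div_rpow (hrb x) hc ht

theorem fracModular_scaling (ha : 0 < a) (hap : ∀ x y, a ≤ p x y) (hpb : ∀ x y, p x y ≤ b)
    (u : Euc N → ℝ) :
    IsModularScaling (fun c => fracModular s p (fun x => u x / c)) a b where
  pos := ha
  down c hc t ht := by
    have ht0 : 0 < t := by linarith
    simp only [fracModular]
    rw [← lintegral_const_mul' _ _ ENNReal.ofReal_ne_top]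
    refine lintegral_mono fun x => ?_
    rw [← lintegral_const_mul' _ _ ENNReal.ofReal_ne_top]
    refine lintegral_mono fun y => ?_
    rw [← ENNReal.ofReal_mul (by positivity), ← mul_div_assoc, ← mul_div_assoc]
    have : 0 ≤ p x y := ha.le.trans (hap x y)
    simp only [← sub_div]
    gcongr
    exact abs_div_rpow_le (hap x y) hc ht
  up c hc t ht := by
    have ht0 : 0 < t := by linarith
    simp only [fracModular]
    rw [← lintegral_const_mul' _ _ ENNReal.ofReal_ne_top]
    refine lintegral_mono fun x => ?_
    rw [← lintegral_const_mul' _ _ ENNReal.ofReal_ne_top]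
    refine lintegral_mono fun y => ?_
    rw [← ENNReal.ofReal_mul (by positivity), ← mul_div_assoc, ← mul_div_assoc]
    have : 0 ≤ p x y := ha.le.trans (hap x y)
    simp only [← sub_div]
    gcongr
    exact le_abs_div_rpow (hpb x y) hc ht

/-- The density `|u(x) - u(y)|^{p(x,y)} / |x - y|^{N + s p(x,y)}`. -/
noncomputable def gagliardo (s : ℝ) (p : Euc N → Euc N → ℝ) (u : Euc N → ℝ) (x y : Euc N) : ℝ :=
  |u x - u y| ^ p x y / ‖x - y‖ ^ ((N : ℝ) + s * p x y)

theorem gagliardo_nonneg (u : Euc N → ℝ) (x y : Euc N) : 0 ≤ gagliardo s p u x y := by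
  unfold gagliardo; positivity

theorem fracModular_le_gagliardo (ha : 1 ≤ a) (hap : ∀ x y, a ≤ p x y) (u : Euc N → ℝ) :
    fracModular s p u ≤ ∫⁻ x, ∫⁻ y, ENNReal.ofReal (gagliardo s p u x y) := by
  refine lintegral_mono fun x => lintegral_mono fun y => ENNReal.ofReal_le_ofReal ?_
  exact div_le_self (gagliardo_nonneg u x y) (ha.trans (hap x y))

theorem gagliardo_le_fracModular (ha : 0 < a) (hap : ∀ x y, a ≤ p x y) (hpb : ∀ x y, p x y ≤ b)
    (u : Euc N → ℝ) :
    ∫⁻ x, ∫⁻ y, ENNReal.ofReal (gagliardo s p u x y) ≤ ENNReal.ofReal b * fracModular s p u := by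
  unfold fracModular
  rw [← lintegral_const_mul' _ _ ENNReal.ofReal_ne_top]
  refine lintegral_mono fun x => ?_
  rw [← lintegral_const_mul' _ _ ENNReal.ofReal_ne_top]
  refine lintegral_mono fun y => ?_
  have h1 := hap x y
  have h2 := hpb x y
  rw [← ENNReal.ofReal_mul (by linarith)]
  apply ENNReal.ofReal_le_ofReal
  change _ ≤ b * (gagliardo s p u x y / p x y)
  rw [← mul_div_assoc, le_div_iff₀ (by linarith), mul_comm]
  exact mul_le_mul_of_nonneg_right h2 (gagliardo_nonneg _ _ _)

theorem measurable_gagliardo (hp : Continuous (fun z : Euc N × Euc N => p z.1 z.2))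
    {u : Euc N → ℝ} (hu : Measurable u) :
    Measurable (fun z : Euc N × Euc N => gagliardo s p u z.1 z.2) := by
  have := hp.measurable
  unfold gagliardo
  fun_prop

theorem lebesgueModular_congr (Ω : Set (Euc N)) (r : Euc N → ℝ) {u v : Euc N → ℝ}
    (h : u =ᵐ[volume] v) : lebesgueModular Ω r u = lebesgueModular Ω r v := by
  refine lintegral_congr_ae (ae_restrict_of_ae ?_)
  filter_upwards [h] with x hx
  rw [hx]

theorem lintegral_lintegral_congr_of_ae {F : ℝ → ℝ → Euc N → Euc N → ℝ≥0∞} {u v : Euc N → ℝ}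
    (h : u =ᵐ[volume] v) :
    ∫⁻ x, ∫⁻ y, F (u x) (u y) x y = ∫⁻ x, ∫⁻ y, F (v x) (v y) x y := by
  refine lintegral_congr_ae ?_
  filter_upwards [h] with x hx
  refine lintegral_congr_ae ?_
  filter_upwards [h] with y hy
  rw [hx, hy]

theorem fracModular_congr {u v : Euc N → ℝ} (h : u =ᵐ[volume] v) :
    fracModular s p u = fracModular s p v :=
  lintegral_lintegral_congr_of_ae
    (F := fun α β x y => ENNReal.ofReal (|α - β| ^ p x y / ‖x - y‖ ^ ((N : ℝ) + s * p x y) / p x y))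
    h

end Modulars

/-! ### `L¹` bound and uniform integrability from bounded energy. -/

section Estimates

variable {N : ℕ} {s a b : ℝ} {p : Euc N → Euc N → ℝ} {Ω : Set (Euc N)}

theorem lintegral_eq_setLIntegral_of_ae_eq_zero (hΩ : MeasurableSet Ω) {f : Euc N → ℝ≥0∞}
    (hf : ∀ᵐ x ∂(volume : Measure (Euc N)), x ∉ Ω → f x = 0) :
    ∫⁻ x, f x = ∫⁻ x in Ω, f x := by
  rw [← lintegral_indicator hΩ]
  refine lintegral_congr_ae ?_
  filter_upwards [hf] with x hx
  by_cases h : x ∈ Ω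
  · simp [h]
  · simp [h, hx h]

theorem abs_le_one_add_rpow {v q : ℝ} (hq : 1 ≤ q) : |v| ≤ 1 + |v| ^ q := by
  rcases le_total |v| 1 with h | h
  · have : 0 ≤ |v| ^ q := by positivity
    linarith
  · have := Real.self_le_rpow_of_one_le h hq
    linarith

theorem abs_sub_rpow_le_mul_gagliardo (u : Euc N → ℝ) {x y : Euc N} {R : ℝ} (hs : 0 ≤ s)
    (hR : 1 ≤ R) (hxy : ‖x - y‖ ≤ R) (hp0 : 0 < p x y) (hpb : p x y ≤ b) :
    |u x - u y| ^ p x y ≤ R ^ ((N : ℝ) + s * b) * gagliardo s p u x y := by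
  rcases eq_or_ne x y with rfl | hne
  · rw [sub_self, abs_zero, Real.zero_rpow hp0.ne']
    exact mul_nonneg (by positivity) (gagliardo_nonneg u x x)
  · have hpos : 0 < ‖x - y‖ := norm_pos_iff.2 (sub_ne_zero.2 hne)
    unfold gagliardo
    rw [← mul_div_assoc, le_div_iff₀ (by positivity), mul_comm]
    gcongr
    calc ‖x - y‖ ^ ((N : ℝ) + s * p x y) ≤ R ^ ((N : ℝ) + s * p x y) := by gcongr
      _ ≤ R ^ ((N : ℝ) + s * b) := by gcongr

/-- A Poincaré inequality: on a ball `D` off `Ω` the function vanishes, so for `x ∈ Ω` the part of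
the energy with `y ∈ D` already controls `|u x| ^ p x y`, and `|v| ≤ 1 + |v| ^ q` brings this down
to `|u x|`. -/
theorem exists_lintegral_enorm_le (hN : 0 < N) (hΩ : MeasurableSet Ω)
    (hbdd : Bornology.IsBounded Ω) (hs : 0 ≤ s) (ha : 1 ≤ a) (hap : ∀ x y, a ≤ p x y)
    (hpb : ∀ x y, p x y ≤ b) :
    ∃ A B : ℝ≥0∞, A ≠ ⊤ ∧ B ≠ ⊤ ∧ ∀ u : Euc N → ℝ, (∀ᵐ x, x ∉ Ω → u x = 0) →
      ∫⁻ x, ‖u x‖ₑ ≤ A + B * ∫⁻ x, ∫⁻ y, ENNReal.ofReal (gagliardo s p u x y) := by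
  obtain ⟨R, hR0, hR⟩ := hbdd.exists_pos_norm_le
  have : Nonempty (Fin N) := ⟨⟨0, hN⟩⟩
  -- Points of the open unit ball around `z` have norm greater than `R`, hence lie outside `Ω`.
  obtain ⟨z, hz⟩ : ∃ z : Euc N, ‖z‖ = R + 1 := exists_norm_eq _ (by linarith)
  set D := Metric.ball z 1 with hD
  have hD0 : volume D ≠ 0 := (Metric.measure_ball_pos volume z one_pos).ne'
  have hDt : volume D ≠ ⊤ := measure_ball_lt_top.ne
  have hDΩ : ∀ y ∈ D, y ∉ Ω := by
    intro y hy hyΩ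
    have h1 := hR y hyΩ
    rw [hD, mem_ball_iff_norm] at hy
    have h2 := norm_sub_norm_le z y
    rw [norm_sub_rev] at h2
    linarith
  set R' := 2 * R + 2 with hR'
  have hdist : ∀ x ∈ Ω, ∀ y ∈ D, ‖x - y‖ ≤ R' := by
    intro x hx y hy
    have h1 := hR x hx
    rw [hD, mem_ball_iff_norm] at hy
    have h2 : ‖x - y‖ ≤ ‖x‖ + ‖y - z‖ + ‖z‖ := by
      calc ‖x - y‖ = ‖x - (y - z) - z‖ := by congr 1; abel
        _ ≤ ‖x - (y - z)‖ + ‖z‖ := norm_sub_le _ _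
        _ ≤ _ := by gcongr; exact norm_sub_le _ _
    linarith
  set C := ENNReal.ofReal (R' ^ ((N : ℝ) + s * b)) with hC
  refine ⟨volume Ω, (volume D)⁻¹ * C, hbdd.measure_lt_top.ne,
    ENNReal.mul_ne_top (ENNReal.inv_ne_top.2 hD0) ENNReal.ofReal_ne_top, fun u hu => ?_⟩
  set I := ∫⁻ x, ∫⁻ y, ENNReal.ofReal (gagliardo s p u x y)
  have key : volume D * ∫⁻ x, ‖u x‖ₑ ≤ volume D * volume Ω + C * I := by
    have h1 : ∀ x ∈ Ω, volume D * ‖u x‖ₑ ≤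
        volume D + C * ∫⁻ y, ENNReal.ofReal (gagliardo s p u x y) := by
      intro x hx
      calc volume D * ‖u x‖ₑ = ∫⁻ _ in D, ‖u x‖ₑ := by rw [setLIntegral_const, mul_comm]
        _ ≤ ∫⁻ y in D, (1 + C * ENNReal.ofReal (gagliardo s p u x y)) := by
          refine lintegral_mono_ae ?_
          filter_upwards [ae_restrict_of_ae hu, ae_restrict_mem measurableSet_ball] with y hy hyD
          have hy0 := hy (hDΩ y hyD)
          have hp1 : 1 ≤ p x y := ha.trans (hap x y)
          rw [hC, ← ENNReal.ofReal_mul (by positivity), ← ENNReal.ofReal_one,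
            ← ENNReal.ofReal_add zero_le_one (mul_nonneg (by positivity) (gagliardo_nonneg _ _ _)),
            Real.enorm_eq_ofReal_abs]
          apply ENNReal.ofReal_le_ofReal
          have h3 := abs_sub_rpow_le_mul_gagliardo (s := s) (p := p) u hs (by linarith)
            (hdist x hx y hyD) (by linarith) (hpb x y)
          have h4 := abs_le_one_add_rpow (v := u x) hp1
          rw [hy0, sub_zero] at h3
          linarith
        _ = volume D + C * ∫⁻ y in D, ENNReal.ofReal (gagliardo s p u x y) := by
          rw [lintegral_add_left measurable_const, setLIntegral_one,
            lintegral_const_mul' _ _ ENNReal.ofReal_ne_top]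
        _ ≤ _ := by
          gcongr
          exact Measure.restrict_le_self
    calc volume D * ∫⁻ x, ‖u x‖ₑ = ∫⁻ x in Ω, volume D * ‖u x‖ₑ := by
          rw [lintegral_eq_setLIntegral_of_ae_eq_zero hΩ, lintegral_const_mul' _ _ hDt]
          filter_upwards [hu] with x hx h
          simp [hx h]
      _ ≤ ∫⁻ x in Ω, (volume D + C * ∫⁻ y, ENNReal.ofReal (gagliardo s p u x y)) :=
          setLIntegral_mono' hΩ h1
      _ = volume D * volume Ω + C * ∫⁻ x in Ω, ∫⁻ y, ENNReal.ofReal (gagliardo s p u x y) := by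
          rw [lintegral_add_left measurable_const, setLIntegral_const,
            lintegral_const_mul' _ _ ENNReal.ofReal_ne_top]
      _ ≤ _ := by
          gcongr
          exact setLIntegral_le_lintegral _ _
  calc ∫⁻ x, ‖u x‖ₑ = (volume D)⁻¹ * (volume D * ∫⁻ x, ‖u x‖ₑ) := by
        rw [← mul_assoc, ENNReal.inv_mul_cancel hD0 hDt, one_mul]
    _ ≤ (volume D)⁻¹ * (volume D * volume Ω + C * I) := by gcongr
    _ = _ := by
        rw [mul_add, ← mul_assoc, ENNReal.inv_mul_cancel hD0 hDt, one_mul, mul_assoc]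

/-- Taking `ρ ≤ 1` keeps `y` in a fixed compact ball, where `p` is uniformly continuous. -/
theorem exists_modulus (hp : Continuous (fun z : Euc N × Euc N => p z.1 z.2))
    (hbdd : Bornology.IsBounded Ω) {δ : ℝ} (hδ : 0 < δ) :
    ∃ ρ > 0, ∀ x ∈ Ω, ∀ y, ‖x - y‖ < ρ → p x x - δ < p x y := by
  obtain ⟨R, hR0, hR⟩ := hbdd.exists_pos_norm_le
  have hK : IsCompact (Metric.closedBall (0 : Euc N) (R + 1) ×ˢ
      Metric.closedBall (0 : Euc N) (R + 1)) :=
    (isCompact_closedBall _ _).prod (isCompact_closedBall _ _)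
  have hu := hK.uniformContinuousOn_of_continuous hp.continuousOn
  rw [Metric.uniformContinuousOn_iff] at hu
  obtain ⟨ρ, hρ, h⟩ := hu δ hδ
  refine ⟨min ρ 1, lt_min hρ one_pos, fun x hx y hxy => ?_⟩
  have hx1 := hR x hx
  have hxy1 := hxy.trans_le (min_le_left _ _)
  have hxy2 := hxy.trans_le (min_le_right _ _)
  have hy1 : ‖y‖ ≤ R + 1 := by
    have := norm_sub_norm_le y x
    rw [norm_sub_rev] at this
    linarith
  have := h (x, x) ⟨by simpa using by linarith, by simpa using by linarith⟩ (x, y)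
    ⟨by simpa using by linarith, by simpa using hy1⟩
    (by simpa [Prod.dist_eq, dist_eq_norm, hρ] using hxy1)
  rw [Real.dist_eq] at this
  have := (abs_lt.1 this).2
  dsimp at this
  linarith

/-- A large value at `x` is isolated, since `u` has bounded `L¹` norm. Most nearby `y` thus have `|u
x - u y| ≥ t / 2`, and integrating the kernel over them yields a power of `t` strictly above `p x
x`. -/
theorem rpow_le_lintegral_gagliardo (hN : 0 < N) (hs : 0 < s) (ha : 1 ≤ a)
    (hap : ∀ x y, a ≤ p x y) (hpb : ∀ x y, p x y ≤ b) {δ k ρ w t : ℝ} (hδ : δ = s * a / (4 * N))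
    (hk : 0 ≤ k) (hw : volume (Metric.ball (0 : Euc N) 1) = ENNReal.ofReal w) (hw0 : 0 < w)
    {u : Euc N → ℝ} (hu : Measurable u) (hL : ∫⁻ x, ‖u x‖ₑ ≤ ENNReal.ofReal k) {x : Euc N}
    (hρ : ∀ y, ‖x - y‖ < ρ → p x x - δ < p x y) (hδp : δ ≤ p x x) (ht : t = |u x|) (ht2 : 2 ≤ t)
    (htk : 4 * k / w ≤ t ^ (1 / 2 : ℝ)) (htρ : t ^ (-(1 / (2 * N) : ℝ)) ≤ ρ) :
    ENNReal.ofReal (w / 2 * 2 ^ (-b) * t ^ (p x x + δ)) ≤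
      ∫⁻ y, ENNReal.ofReal (gagliardo s p u x y) := by
  have ht0 : 0 < t := by linarith
  have hNR : (0 : ℝ) < N := by exact_mod_cast hN
  -- With this exponent `r ^ N = t ^ (-1/2)`, which beats the Chebyshev bound `2k/t` for the bad set
  -- `S`, while `r ^ (-(s * a)) = t ^ (2δ)` is the gain.
  set r := t ^ (-(1 / (2 * N) : ℝ)) with hr
  have hr0 : 0 < r := by positivity
  have hr1 : r ≤ 1 := Real.rpow_le_one_of_one_le_of_nonpos (by linarith) (by
    rw [neg_nonpos]; positivity)
  have hrN : r ^ N = t ^ (-(1 / 2) : ℝ) := by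
    rw [hr, ← Real.rpow_natCast, ← Real.rpow_mul ht0.le]
    congr 1; field_simp
  set S := {y | ENNReal.ofReal (t / 2) ≤ ‖u y‖ₑ} with hS
  have hSv : volume S ≤ ENNReal.ofReal (2 * k / t) := by
    have h1 := (mul_meas_ge_le_lintegral (μ := (volume : Measure (Euc N))) hu.enorm
      (ENNReal.ofReal (t / 2))).trans hL
    have h2 : ENNReal.ofReal (2 * k / t) = ENNReal.ofReal k / ENNReal.ofReal (t / 2) := by
      rw [← ENNReal.ofReal_div_of_pos (by positivity)]; congr 1; field_simp
    rw [h2, ENNReal.le_div_iff_mul_le (Or.inl (by simpa using ht0)) (Or.inl ENNReal.ofReal_ne_top),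
      mul_comm]
    exact h1
  have hBv : volume (Metric.ball x r) = ENNReal.ofReal (w * r ^ N) := by
    rw [Measure.addHaar_ball_of_pos volume x hr0, hw, finrank_euclideanSpace_fin,
      ← ENNReal.ofReal_mul (by positivity), mul_comm]
  have hA : ENNReal.ofReal (w * r ^ N / 2) ≤ volume (Metric.ball x r \ S) := by
    refine le_trans ?_ le_measure_sdiff
    rw [hBv]
    have h3 : 2 * k / t ≤ w * r ^ N / 2 := by
      rw [hrN, Real.rpow_neg ht0.le]
      rw [div_le_iff₀ hw0] at htk
      have h4 : t ^ (1 / 2 : ℝ) * t ^ (1 / 2 : ℝ) = t := by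
        rw [← Real.rpow_add ht0]; norm_num
      have h5 : 0 < t ^ (1 / 2 : ℝ) := by positivity
      set q := t ^ (1 / 2 : ℝ)
      rw [← h4]
      field_simp
      linarith
    calc ENNReal.ofReal (w * r ^ N / 2)
        ≤ ENNReal.ofReal (w * r ^ N - 2 * k / t) := ENNReal.ofReal_le_ofReal (by linarith)
      _ = ENNReal.ofReal (w * r ^ N) - ENNReal.ofReal (2 * k / t) :=
          ENNReal.ofReal_sub _ (by positivity)
      _ ≤ _ := by gcongr
  have hG : ∀ y ∈ Metric.ball x r \ S,
      (t / 2) ^ (p x x - δ) / r ^ ((N : ℝ) + s * a) ≤ gagliardo s p u x y := by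
    rintro y ⟨hy, hyS⟩
    rw [mem_ball_iff_norm, norm_sub_rev] at hy
    have hyS' : |u y| < t / 2 := by
      by_contra! hcon
      exact hyS (by
        change _ ≤ ‖u y‖ₑ
        rw [Real.enorm_eq_ofReal_abs]; exact ENNReal.ofReal_le_ofReal hcon)
    have hne : x ≠ y := by
      rintro rfl
      linarith
    have hpos : 0 < ‖x - y‖ := norm_pos_iff.2 (sub_ne_zero.2 hne)
    -- As `t / 2 ≥ 1`, the exponent `p x y` may be lowered to `p x x - δ` below.
    have hd : t / 2 ≤ |u x - u y| := by
      have := abs_sub_abs_le_abs_sub (u x) (u y)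
      linarith
    have hpxy := hρ y (hy.trans_le htρ)
    have hap' := hap x y
    unfold gagliardo
    apply div_le_div₀ (by positivity) _ (by positivity)
    · calc ‖x - y‖ ^ ((N : ℝ) + s * p x y) ≤ r ^ ((N : ℝ) + s * p x y) := by
            have : 0 ≤ p x y := by linarith
            gcongr
        _ ≤ r ^ ((N : ℝ) + s * a) :=
            Real.rpow_le_rpow_of_exponent_ge hr0 hr1 (by gcongr)
    · calc (t / 2) ^ (p x x - δ) ≤ |u x - u y| ^ (p x x - δ) := by
            have : 0 ≤ p x x - δ := by linarith
            gcongr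
        _ ≤ |u x - u y| ^ p x y := Real.rpow_le_rpow_of_exponent_le (by linarith) hpxy.le
  have hconst : w / 2 * 2 ^ (-b) * t ^ (p x x + δ) ≤
      (t / 2) ^ (p x x - δ) / r ^ ((N : ℝ) + s * a) * (w * r ^ N / 2) := by
    have h1 : r ^ ((N : ℝ) + s * a) = r ^ N * t ^ (-(2 * δ)) := by
      rw [Real.rpow_add hr0, Real.rpow_natCast]
      congr 1
      rw [hr, ← Real.rpow_mul ht0.le, hδ]
      congr 1
      field_simp
      ring
    have h2 : t ^ (p x x + δ) = t ^ (p x x - δ) * t ^ (2 * δ) := by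
      rw [← Real.rpow_add ht0]; congr 1; ring
    have h3 : (t / 2) ^ (p x x - δ) = t ^ (p x x - δ) * 2 ^ (-(p x x - δ)) := by
      rw [Real.div_rpow ht0.le (by norm_num), Real.rpow_neg (by norm_num), div_eq_mul_inv]
    have h4 : (2 : ℝ) ^ (-b) ≤ 2 ^ (-(p x x - δ)) := by
      apply Real.rpow_le_rpow_of_exponent_le (by norm_num)
      have : 0 ≤ δ := by rw [hδ]; positivity
      linarith [hpb x x]
    have h5 : 0 < r ^ N := by positivity
    rw [h1, h2, h3, Real.rpow_neg ht0.le]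
    have h6 : 0 < t ^ (2 * δ) := by positivity
    have h7 : 0 < t ^ (p x x - δ) := by positivity
    set X1 := t ^ (2 * δ)
    set X2 := t ^ (p x x - δ)
    set X3 := (2 : ℝ) ^ (-b)
    set X4 := (2 : ℝ) ^ (-(p x x - δ))
    have : X2 * X4 / (r ^ N * X1⁻¹) * (w * r ^ N / 2) = w / 2 * X4 * (X2 * X1) := by
      field_simp
    rw [this]
    gcongr
  calc ENNReal.ofReal (w / 2 * 2 ^ (-b) * t ^ (p x x + δ))
      ≤ ENNReal.ofReal ((t / 2) ^ (p x x - δ) / r ^ ((N : ℝ) + s * a)) *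
          ENNReal.ofReal (w * r ^ N / 2) := by
        rw [← ENNReal.ofReal_mul (by positivity)]
        exact ENNReal.ofReal_le_ofReal hconst
    _ ≤ ENNReal.ofReal ((t / 2) ^ (p x x - δ) / r ^ ((N : ℝ) + s * a)) *
          volume (Metric.ball x r \ S) := by gcongr
    _ = ∫⁻ _ in Metric.ball x r \ S,
          ENNReal.ofReal ((t / 2) ^ (p x x - δ) / r ^ ((N : ℝ) + s * a)) :=
        (setLIntegral_const _ _).symm
    _ ≤ ∫⁻ y in Metric.ball x r \ S, ENNReal.ofReal (gagliardo s p u x y) :=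
        setLIntegral_mono' (measurableSet_ball.diff (measurableSet_le measurable_const hu.enorm))
          fun y hy => ENNReal.ofReal_le_ofReal (hG y hy)
    _ ≤ _ := setLIntegral_le_lintegral _ _

/-- Where `|u| ≥ T`, the surplus factor `|u x| ^ δ ≥ T ^ δ` bounds `|u x| ^ p x x` by `T ^ (-δ)`
times the inner energy, up to a constant; integrate in `x` and take `T` large. -/
theorem exists_setLIntegral_rpow_le (hN : 0 < N) (hΩ : MeasurableSet Ω)
    (hbdd : Bornology.IsBounded Ω) (hs : s ∈ Ioo (0 : ℝ) 1) (ha : 1 ≤ a) (hap : ∀ x y, a ≤ p x y)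
    (hpb : ∀ x y, p x y ≤ b) (hp : Continuous (fun z : Euc N × Euc N => p z.1 z.2))
    {K M : ℝ≥0∞} (hK : K ≠ ⊤) (hM : M ≠ ⊤) {κ : ℝ≥0∞} (hκ : 0 < κ) :
    ∃ T : ℝ, 0 < T ∧ ∀ u : Euc N → ℝ, Measurable u → ∫⁻ x, ‖u x‖ₑ ≤ K →
      ∫⁻ x, ∫⁻ y, ENNReal.ofReal (gagliardo s p u x y) ≤ M →
      ∫⁻ x in Ω ∩ {x | T ≤ |u x|}, ENNReal.ofReal (|u x| ^ p x x) ≤ κ := by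
  have hNR : (0 : ℝ) < N := by exact_mod_cast hN
  have hN1 : (1 : ℝ) ≤ N := by exact_mod_cast hN
  set δ := s * a / (4 * N) with hδ
  have hδ0 : 0 < δ := by have := hs.1; positivity
  have hδa : δ ≤ a := by
    rw [hδ, div_le_iff₀ (by positivity)]
    nlinarith [hs.2, hs.1]
  obtain ⟨ρ, hρ0, hρ⟩ := exists_modulus hp hbdd hδ0
  set w := (volume (Metric.ball (0 : Euc N) 1)).toReal with hwdef
  have hwt : volume (Metric.ball (0 : Euc N) 1) ≠ ⊤ := measure_ball_lt_top.ne
  have hw : volume (Metric.ball (0 : Euc N) 1) = ENNReal.ofReal w :=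
    (ENNReal.ofReal_toReal hwt).symm
  have hw0 : 0 < w :=
    ENNReal.toReal_pos (Metric.measure_ball_pos volume _ one_pos).ne' hwt
  have e1 : ∀ᶠ t : ℝ in atTop, 4 * K.toReal / w ≤ t ^ (1 / 2 : ℝ) :=
    (tendsto_rpow_atTop (by norm_num)).eventually_ge_atTop _
  have e2 : ∀ᶠ t : ℝ in atTop, t ^ (-(1 / (2 * N) : ℝ)) ≤ ρ :=
    (tendsto_rpow_neg_atTop (by positivity)).eventually_le_const hρ0
  have e3 : ∀ᶠ t : ℝ in atTop,
      ENNReal.ofReal ((w / 2 * 2 ^ (-b))⁻¹ * t ^ (-δ)) * M ≤ κ := by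
    have h1 : Tendsto (fun t : ℝ => ENNReal.ofReal ((w / 2 * 2 ^ (-b))⁻¹ * t ^ (-δ)) * M) atTop
        (𝓝 0) := by
      have h2 := (tendsto_rpow_neg_atTop hδ0).const_mul (w / 2 * 2 ^ (-b))⁻¹
      rw [mul_zero] at h2
      have h3 := ENNReal.tendsto_ofReal h2
      rw [ENNReal.ofReal_zero] at h3
      simpa using ENNReal.Tendsto.mul_const h3 (Or.inr hM)
    exact h1.eventually_le_const hκ
  -- `e1` and `e2` are needed at every `t = |u x| ≥ T`, but `e3` only at `T` itself.
  obtain ⟨T₀, hT₀⟩ := eventually_atTop.1 (e1.and e2)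
  obtain ⟨T, hT3, hT⟩ := (e3.and (eventually_ge_atTop (max T₀ 2))).exists
  have hT2 : 2 ≤ T := (le_max_right _ _).trans hT
  refine ⟨T, by linarith, fun u hu huK huM => ?_⟩
  set c := w / 2 * 2 ^ (-b) with hc
  have hc0 : 0 < c := by positivity
  have hmeas : MeasurableSet (Ω ∩ {x | T ≤ |u x|}) :=
    hΩ.inter (measurableSet_le measurable_const (by fun_prop))
  calc ∫⁻ x in Ω ∩ {x | T ≤ |u x|}, ENNReal.ofReal (|u x| ^ p x x)
      ≤ ∫⁻ x in Ω ∩ {x | T ≤ |u x|}, ENNReal.ofReal (c⁻¹ * T ^ (-δ)) *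
          ∫⁻ y, ENNReal.ofReal (gagliardo s p u x y) := by
        refine setLIntegral_mono' hmeas ?_
        rintro x ⟨hx, hxT⟩
        change T ≤ |u x| at hxT
        obtain ⟨h1, h2⟩ := hT₀ |u x| ((le_max_left _ _).trans (hT.trans hxT))
        have h3 := rpow_le_lintegral_gagliardo hN hs.1 ha hap hpb hδ ENNReal.toReal_nonneg hw hw0
          hu (huK.trans_eq (ENNReal.ofReal_toReal hK).symm) (hρ x hx) (hδa.trans (hap x x)) rfl
          (hT2.trans hxT) h1 h2
        refine le_trans ?_ (mul_le_mul_right h3 _)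
        rw [← ENNReal.ofReal_mul (by positivity)]
        apply ENNReal.ofReal_le_ofReal
        have hT0 : 0 < T := by linarith
        have hu0 : 0 < |u x| := by linarith
        rw [Real.rpow_add hu0, Real.rpow_neg hT0.le]
        have h4 : T ^ δ ≤ |u x| ^ δ := by gcongr
        have h5 : 0 < T ^ δ := by positivity
        have h6 : c⁻¹ * (T ^ δ)⁻¹ * (c * (|u x| ^ p x x * |u x| ^ δ)) =
            |u x| ^ p x x * (|u x| ^ δ / T ^ δ) := by field_simp
        rw [h6]
        exact le_mul_of_one_le_right (by positivity) ((one_le_div h5).2 h4)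
    _ = ENNReal.ofReal (c⁻¹ * T ^ (-δ)) * ∫⁻ x in Ω ∩ {x | T ≤ |u x|},
          ∫⁻ y, ENNReal.ofReal (gagliardo s p u x y) :=
        lintegral_const_mul' _ _ ENNReal.ofReal_ne_top
    _ ≤ ENNReal.ofReal (c⁻¹ * T ^ (-δ)) * M := by
        gcongr
        exact (setLIntegral_le_lintegral _ _).trans huM
    _ ≤ κ := hT3

end Estimates

/-! ### The partition of space into small cubes. -/

section Cells

variable {N : ℕ}

/-- The half-open cube of side `ε` with lower corner `ε k`. -/
def cell (ε : ℝ) (k : Fin N → ℤ) : Set (Euc N) := {x | ∀ i, ⌊x i / ε⌋ = k i}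

theorem measurableSet_cell (ε : ℝ) (k : Fin N → ℤ) : MeasurableSet (cell ε k) := by
  have : cell ε k = ⋂ i, (fun x : Euc N => ⌊x i / ε⌋) ⁻¹' {k i} := by ext; simp [cell]
  rw [this]
  refine MeasurableSet.iInter fun i => measurableSet_preimage ?_ (measurableSet_singleton _)
  fun_prop

theorem pairwise_disjoint_cell (ε : ℝ) : Pairwise (Function.onFun Disjoint (cell (N := N) ε)) := by
  intro k l hkl
  refine Set.disjoint_left.2 fun x hx hy => hkl ?_
  ext i
  rw [← hx i, ← hy i]

theorem volume_cell {ε : ℝ} (hε : 0 < ε) (k : Fin N → ℤ) :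
    volume (cell ε k) = ENNReal.ofReal (ε ^ N) := by
  have h : cell ε k = (MeasurableEquiv.toLp 2 (Fin N → ℝ)).symm ⁻¹'
      (Set.pi univ fun i => Ico (ε * k i) (ε * (k i + 1))) := by
    ext x
    simp only [cell, mem_ofPred_eq, mem_preimage, mem_univ_pi, mem_Ico, Int.floor_eq_iff]
    refine forall_congr' fun i => ?_
    rw [le_div_iff₀ hε, div_lt_iff₀ hε, mul_comm, mul_comm ε (_ + 1)]
    rfl
  rw [h, (EuclideanSpace.volume_preserving_symm_measurableEquiv_toLp (Fin N)).measure_preimage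
    (MeasurableSet.univ_pi fun i => measurableSet_Ico).nullMeasurableSet, Real.volume_pi_Ico]
  simp [mul_add, ENNReal.ofReal_pow hε.le]

theorem norm_sub_le_of_mem_cell {ε : ℝ} (hε : 0 < ε) {k : Fin N → ℤ} {x y : Euc N}
    (hx : x ∈ cell ε k) (hy : y ∈ cell ε k) : ‖x - y‖ ≤ N * ε := by
  have h : ∀ i, ‖(x - y) i‖ ≤ ε := by
    intro i
    have h1 := Int.abs_sub_lt_one_of_floor_eq_floor ((hx i).trans (hy i).symm)
    rw [← sub_div, abs_div, abs_of_pos hε, div_lt_one hε] at h1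
    exact h1.le
  rw [EuclideanSpace.norm_eq]
  refine Real.sqrt_le_iff.2 ⟨by positivity, ?_⟩
  calc ∑ i, ‖(x - y) i‖ ^ 2 ≤ ∑ _i : Fin N, ε ^ 2 :=
        Finset.sum_le_sum fun i _ => pow_le_pow_left₀ (norm_nonneg _) (h i) 2
    _ = N * ε ^ 2 := by simp
    _ ≤ (N * ε) ^ 2 := by
        rw [mul_pow]
        gcongr
        exact_mod_cast Nat.le_self_pow two_ne_zero N

theorem finite_setOf_cell_inter_nonempty {Ω : Set (Euc N)} (hbdd : Bornology.IsBounded Ω)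
    {ε : ℝ} (hε : 0 < ε) : {k : Fin N → ℤ | (cell ε k ∩ Ω).Nonempty}.Finite := by
  obtain ⟨R, hR0, hR⟩ := hbdd.exists_pos_norm_le
  refine (Set.finite_Icc (fun _ : Fin N => ⌊-R / ε⌋) (fun _ => ⌊R / ε⌋)).subset ?_
  rintro k ⟨x, hx, hxΩ⟩
  have h : ∀ i, |x i| ≤ R := fun i => (PiLp.norm_apply_le x i).trans (hR x hxΩ)
  constructor
  · intro i
    rw [← hx i]
    exact Int.floor_le_floor (by gcongr; exact (abs_le.1 (h i)).1)
  · intro i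
    rw [← hx i]
    exact Int.floor_le_floor (by gcongr; exact (abs_le.1 (h i)).2)

end Cells

/-- Compare with the mean: `μ(univ) v(x) = ∫ v + ∫ (v(x) - v(y)) dμ(y)`, then integrate absolute
values in `x`. -/
theorem measure_mul_lintegral_enorm_le {α : Type*} [MeasurableSpace α] {μ : Measure α}
    [IsFiniteMeasure μ] {v : α → ℝ} (hv : Integrable v μ) :
    μ univ * ∫⁻ x, ‖v x‖ₑ ∂μ ≤
      μ univ * ‖∫ x, v x ∂μ‖ₑ + ∫⁻ x, ∫⁻ y, ‖v x - v y‖ₑ ∂μ ∂μ := by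
  have h : ∀ x, μ univ * ‖v x‖ₑ ≤ ‖∫ y, v y ∂μ‖ₑ + ∫⁻ y, ‖v x - v y‖ₑ ∂μ := by
    intro x
    have h1 : μ.real univ * v x = (∫ y, v y ∂μ) + ∫ y, (v x - v y) ∂μ := by
      rw [integral_sub (integrable_const _) hv, integral_const, smul_eq_mul]
      ring
    calc μ univ * ‖v x‖ₑ = ‖μ.real univ * v x‖ₑ := by
          rw [enorm_mul, Real.enorm_eq_ofReal measureReal_nonneg, ofReal_measureReal]
      _ ≤ ‖∫ y, v y ∂μ‖ₑ + ‖∫ y, (v x - v y) ∂μ‖ₑ := by rw [h1]; exact enorm_add_le _ _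
      _ ≤ _ := by gcongr; exact enorm_integral_le_lintegral_enorm _
  calc μ univ * ∫⁻ x, ‖v x‖ₑ ∂μ = ∫⁻ x, μ univ * ‖v x‖ₑ ∂μ :=
        (lintegral_const_mul' _ _ (measure_ne_top μ _)).symm
    _ ≤ ∫⁻ x, (‖∫ y, v y ∂μ‖ₑ + ∫⁻ y, ‖v x - v y‖ₑ ∂μ) ∂μ := lintegral_mono h
    _ = _ := by rw [lintegral_add_left measurable_const, lintegral_const, mul_comm]

/-! ### Precompactness in `L¹` of functions of bounded energy. -/

section Compactness

variable {N : ℕ} {s a b : ℝ} {p : Euc N → Euc N → ℝ} {Ω : Set (Euc N)}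

/-- Apply `v ≤ 1 + v ^ q` to the Hölder quotient `|u x - u y| / ‖x - y‖ ^ s`. The factor `d ^ s` is
what makes the oscillation over small cells small. -/
theorem abs_sub_le_mul_gagliardo (u : Euc N → ℝ) {x y : Euc N} {d : ℝ} (hs : 0 ≤ s)
    (hxy : ‖x - y‖ ≤ d) (hp1 : 1 ≤ p x y) :
    |u x - u y| ≤ d ^ s * (1 + d ^ N * gagliardo s p u x y) := by
  have hd : 0 ≤ d := (norm_nonneg _).trans hxy
  rcases eq_or_ne x y with rfl | hne
  · rw [sub_self, abs_zero]
    have := gagliardo_nonneg (s := s) (p := p) u x x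
    positivity
  · have hpos : 0 < ‖x - y‖ := norm_pos_iff.2 (sub_ne_zero.2 hne)
    set m := ‖x - y‖ with hm
    have h1 := abs_le_one_add_rpow (v := |u x - u y| / m ^ s) hp1
    rw [abs_of_nonneg (by positivity), Real.div_rpow (abs_nonneg _) (by positivity),
      ← Real.rpow_mul hpos.le] at h1
    have h2 : |u x - u y| ^ p x y / m ^ (s * p x y) = m ^ N * gagliardo s p u x y := by
      unfold gagliardo
      rw [← hm, Real.rpow_add hpos, Real.rpow_natCast]
      field_simp
    rw [h2, div_le_iff₀ (by positivity)] at h1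
    have h3 := gagliardo_nonneg (s := s) (p := p) u x y
    calc |u x - u y| ≤ m ^ s * (1 + m ^ N * gagliardo s p u x y) := by linarith
      _ ≤ _ := by gcongr

/-- The mean oscillation of `u` over small cells is controlled by the fractional energy. -/
theorem sum_lintegral_cell_le (hs : 0 ≤ s) (hap : ∀ x y, 1 ≤ p x y) {ε : ℝ} (hε : 0 < ε)
    (F : Finset (Fin N → ℤ)) (u : Euc N → ℝ) :
    ∑ k ∈ F, ∫⁻ x in cell ε k, ∫⁻ y in cell ε k, ‖u x - u y‖ₑ ≤
      ENNReal.ofReal (ε ^ N) * (ENNReal.ofReal ((N * ε) ^ s) * (volume (⋃ k ∈ F, cell ε k) +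
        ENNReal.ofReal (N ^ N) * ∫⁻ x, ∫⁻ y, ENNReal.ofReal (gagliardo s p u x y))) := by
  have hd0 : 0 ≤ N * ε := by positivity
  have h1 : ∀ k ∈ F, ∫⁻ x in cell ε k, ∫⁻ y in cell ε k, ‖u x - u y‖ₑ ≤
      ∫⁻ x in cell ε k, ENNReal.ofReal (ε ^ N) * (ENNReal.ofReal ((N * ε) ^ s) * (1 +
        ENNReal.ofReal (N ^ N) * ∫⁻ y, ENNReal.ofReal (gagliardo s p u x y))) := by
    intro k _
    refine setLIntegral_mono' (measurableSet_cell ε k) fun x hx => ?_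
    calc ∫⁻ y in cell ε k, ‖u x - u y‖ₑ
        ≤ ∫⁻ y in cell ε k, ENNReal.ofReal ((N * ε) ^ s) * (1 +
            ENNReal.ofReal ((N * ε) ^ N) * ENNReal.ofReal (gagliardo s p u x y)) := by
          refine setLIntegral_mono' (measurableSet_cell ε k) fun y hy => ?_
          have hg := gagliardo_nonneg (s := s) (p := p) u x y
          rw [Real.enorm_eq_ofReal_abs, ← ENNReal.ofReal_mul (by positivity), ← ENNReal.ofReal_one,
            ← ENNReal.ofReal_add zero_le_one (by positivity), ← ENNReal.ofReal_mul (by positivity)]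
          exact ENNReal.ofReal_le_ofReal
            (abs_sub_le_mul_gagliardo u hs (norm_sub_le_of_mem_cell hε hx hy) (hap x y))
      _ = ENNReal.ofReal ((N * ε) ^ s) * (ENNReal.ofReal (ε ^ N) + ENNReal.ofReal ((N * ε) ^ N) *
            ∫⁻ y in cell ε k, ENNReal.ofReal (gagliardo s p u x y)) := by
          rw [lintegral_const_mul' _ _ ENNReal.ofReal_ne_top, lintegral_add_left measurable_const,
            setLIntegral_one, volume_cell hε, lintegral_const_mul' _ _ ENNReal.ofReal_ne_top]
      _ ≤ ENNReal.ofReal ((N * ε) ^ s) * (ENNReal.ofReal (ε ^ N) + ENNReal.ofReal ((N * ε) ^ N) *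
            ∫⁻ y, ENNReal.ofReal (gagliardo s p u x y)) := by
          gcongr
          exact Measure.restrict_le_self
      _ = _ := by
          rw [mul_pow, ENNReal.ofReal_mul (by positivity)]
          ring
  refine (Finset.sum_le_sum h1).trans ?_
  rw [← lintegral_biUnion_finset (fun k _ l _ hkl => pairwise_disjoint_cell ε hkl)
    (fun k _ => measurableSet_cell ε k), lintegral_const_mul' _ _ ENNReal.ofReal_ne_top,
    lintegral_const_mul' _ _ ENNReal.ofReal_ne_top, lintegral_add_left measurable_const,
    setLIntegral_one, lintegral_const_mul' _ _ ENNReal.ofReal_ne_top]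
  gcongr
  exact Measure.restrict_le_self

theorem lintegral_lintegral_enorm_sub_le {α : Type*} [MeasurableSpace α] {μ : Measure α}
    {u v : α → ℝ} (hu : Measurable u) [SFinite μ] :
    ∫⁻ x, ∫⁻ y, ‖(u x - v x) - (u y - v y)‖ₑ ∂μ ∂μ ≤
      (∫⁻ x, ∫⁻ y, ‖u x - u y‖ₑ ∂μ ∂μ) + ∫⁻ x, ∫⁻ y, ‖v x - v y‖ₑ ∂μ ∂μ := by
  have hm : Measurable fun z : α × α => ‖u z.1 - u z.2‖ₑ := by fun_prop
  rw [← lintegral_add_left hm.lintegral_prod_right']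
  refine lintegral_mono fun x => ?_
  rw [← lintegral_add_left (by fun_prop)]
  refine lintegral_mono fun y => ?_
  rw [sub_sub_sub_comm]
  exact enorm_sub_le

/-- Functions of bounded energy are determined in `L¹`, up to a small error, by their integrals over
finitely many sets. -/
theorem exists_finset_lintegral_enorm_sub_le (hΩ : MeasurableSet Ω)
    (hbdd : Bornology.IsBounded Ω) (hs : 0 < s) (hap : ∀ x y, 1 ≤ p x y)
    {M : ℝ≥0∞} (hM : M ≠ ⊤) {κ : ℝ≥0∞} (hκ : 0 < κ) :
    ∃ F : Finset (Set (Euc N)), ∀ u v : Euc N → ℝ,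
      Measurable u → Measurable v → Integrable u → Integrable v →
      (∀ᵐ x, x ∉ Ω → u x = 0) → (∀ᵐ x, x ∉ Ω → v x = 0) →
      ∫⁻ x, ∫⁻ y, ENNReal.ofReal (gagliardo s p u x y) ≤ M →
      ∫⁻ x, ∫⁻ y, ENNReal.ofReal (gagliardo s p v x y) ≤ M →
      ∫⁻ x, ‖u x - v x‖ₑ ≤ κ + ∑ E ∈ F, ‖(∫ x in E, u x) - ∫ x in E, v x‖ₑ := by
  classical
  obtain ⟨R, hR0, hR⟩ := hbdd.exists_pos_norm_le
  -- For `ε ≤ 1` cells have diameter at most `N`, so all cells meeting `Ω` lie in this ball and `W`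
  -- does not depend on `ε`.
  set W := volume (Metric.closedBall (0 : Euc N) (R + N)) + ENNReal.ofReal (N ^ N) * M with hW
  have hWt : W ≠ ⊤ := ENNReal.add_ne_top.2
    ⟨measure_closedBall_lt_top.ne, ENNReal.mul_ne_top ENNReal.ofReal_ne_top hM⟩
  obtain ⟨ε, hεκ, hε1, hε⟩ : ∃ ε : ℝ,
      ENNReal.ofReal ((N * ε) ^ s) * W + ENNReal.ofReal ((N * ε) ^ s) * W ≤ κ ∧ ε ≤ 1 ∧ 0 < ε := by
    have h1 : Tendsto (fun ε : ℝ => ENNReal.ofReal ((N * ε) ^ s)) (𝓝[>] 0) (𝓝 0) := by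
      have h2 : Continuous fun ε : ℝ => ENNReal.ofReal ((N * ε) ^ s) :=
        ENNReal.continuous_ofReal.comp
          ((continuous_const.mul continuous_id).rpow_const fun _ => Or.inr hs.le)
      have h3 := (h2.tendsto 0).mono_left (nhdsWithin_le_nhds (s := Ioi 0))
      simpa [Real.zero_rpow hs.ne'] using h3
    have h4 := ENNReal.Tendsto.mul_const h1 (Or.inr hWt)
    have h5 := h4.add h4
    rw [zero_mul, zero_add] at h5
    have h6 : ∀ᶠ ε : ℝ in 𝓝[>] 0, ε ≤ 1 :=
      (eventually_le_nhds one_pos).filter_mono nhdsWithin_le_nhds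
    exact ((h5.eventually_le_const hκ).and (h6.and self_mem_nhdsWithin)).exists
  set F₀ := (finite_setOf_cell_inter_nonempty hbdd hε).toFinset with hF₀
  have hcover : Ω ⊆ ⋃ k ∈ F₀, cell ε k := by
    intro x hx
    simp only [mem_iUnion, exists_prop]
    exact ⟨fun i => ⌊x i / ε⌋, by
      rw [hF₀, Set.Finite.mem_toFinset]; exact ⟨x, fun _ => rfl, hx⟩, fun _ => rfl⟩
  have hsub : (⋃ k ∈ F₀, cell ε k) ⊆ Metric.closedBall 0 (R + N) := by
    intro y hy
    simp only [mem_iUnion, exists_prop] at hy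
    obtain ⟨k, hk, hyk⟩ := hy
    rw [hF₀, Set.Finite.mem_toFinset] at hk
    obtain ⟨x, hx, hxΩ⟩ := hk
    have h1 := norm_sub_le_of_mem_cell hε hyk hx
    have h2 := norm_sub_norm_le y x
    have h3 := hR x hxΩ
    have h4 : N * ε ≤ N := mul_le_of_le_one_right (by positivity) hε1
    rw [mem_closedBall_zero_iff]
    linarith
  have hosc : ∀ u : Euc N → ℝ, ∫⁻ x, ∫⁻ y, ENNReal.ofReal (gagliardo s p u x y) ≤ M →
      ∑ k ∈ F₀, ∫⁻ x in cell ε k, ∫⁻ y in cell ε k, ‖u x - u y‖ₑ ≤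
        ENNReal.ofReal (ε ^ N) * (ENNReal.ofReal ((N * ε) ^ s) * W) := by
    intro u hu
    refine (sum_lintegral_cell_le hs.le hap hε F₀ u).trans ?_
    rw [hW]
    gcongr
  set V := ENNReal.ofReal (ε ^ N) with hV
  have hV0 : V ≠ 0 := by rw [hV]; exact (ENNReal.ofReal_pos.2 (by positivity)).ne'
  have hVt : V ≠ ⊤ := ENNReal.ofReal_ne_top
  refine ⟨F₀.image (cell ε), fun u v hu hv hui hvi hu0 hv0 huM hvM => ?_⟩
  -- Indices in `F₀` have nonempty cells, and distinct cells are disjoint.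
  have hinj : Set.InjOn (cell (N := N) ε) F₀ := by
    intro k hk l hl hkl
    by_contra hne
    have h1 := pairwise_disjoint_cell (N := N) ε hne
    rw [hF₀, Set.Finite.coe_toFinset] at hk
    obtain ⟨x, hx, -⟩ := hk
    exact Set.disjoint_left.1 h1 hx (hkl ▸ hx)
  rw [Finset.sum_image hinj]
  have h0 : ∫⁻ x, ‖u x - v x‖ₑ ≤ ∑ k ∈ F₀, ∫⁻ x in cell ε k, ‖u x - v x‖ₑ := by
    rw [lintegral_eq_setLIntegral_of_ae_eq_zero hΩ,
      ← lintegral_biUnion_finset (fun k _ l _ hkl => pairwise_disjoint_cell ε hkl)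
      (fun k _ => measurableSet_cell ε k)]
    · exact lintegral_mono_set hcover
    · filter_upwards [hu0, hv0] with x h1 h2 h
      simp [h1 h, h2 h]
  have hcell : ∀ k ∈ F₀, V * ∫⁻ x in cell ε k, ‖u x - v x‖ₑ ≤
      V * ‖(∫ x in cell ε k, u x) - ∫ x in cell ε k, v x‖ₑ +
      ((∫⁻ x in cell ε k, ∫⁻ y in cell ε k, ‖u x - u y‖ₑ) +
        ∫⁻ x in cell ε k, ∫⁻ y in cell ε k, ‖v x - v y‖ₑ) := by
    intro k _
    have : IsFiniteMeasure (volume.restrict (cell ε k)) :=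
      ⟨by rw [Measure.restrict_apply_univ, volume_cell hε]; exact ENNReal.ofReal_lt_top⟩
    have h1 := measure_mul_lintegral_enorm_le (μ := volume.restrict (cell ε k))
      (hui.sub hvi).restrict
    simp only [Measure.restrict_apply_univ, volume_cell hε, Pi.sub_apply] at h1
    rw [integral_sub hui.restrict hvi.restrict] at h1
    refine h1.trans ?_
    gcongr
    exact lintegral_lintegral_enorm_sub_le (μ := volume.restrict (cell ε k)) hu
  have key : V * ∫⁻ x, ‖u x - v x‖ₑ ≤
      V * (κ + ∑ k ∈ F₀, ‖(∫ x in cell ε k, u x) - ∫ x in cell ε k, v x‖ₑ) := by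
    calc V * ∫⁻ x, ‖u x - v x‖ₑ ≤ ∑ k ∈ F₀, V * ∫⁻ x in cell ε k, ‖u x - v x‖ₑ := by
          rw [← Finset.mul_sum]; gcongr
      _ ≤ _ := Finset.sum_le_sum hcell
      _ ≤ V * ∑ k ∈ F₀, ‖(∫ x in cell ε k, u x) - ∫ x in cell ε k, v x‖ₑ +
          (V * (ENNReal.ofReal ((N * ε) ^ s) * W) + V * (ENNReal.ofReal ((N * ε) ^ s) * W)) := by
          rw [Finset.sum_add_distrib, Finset.sum_add_distrib, ← Finset.mul_sum]
          gcongr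
          · exact hosc u huM
          · exact hosc v hvM
      _ ≤ _ := by
          rw [← mul_add, ← mul_add, add_comm]
          gcongr
  exact (ENNReal.mul_le_mul_iff_right hV0 hVt).1 key

/-- For each error `1/(m+1)` finitely many test sets suffice. Making all these countably many
integrals converge along one subsequence renders it Cauchy in `L¹`, and a further subsequence
converges a.e. -/
theorem exists_subseq_tendsto_ae (hN : 0 < N) (hΩ : MeasurableSet Ω)
    (hbdd : Bornology.IsBounded Ω) (hs : 0 < s) (hap : ∀ x y, 1 ≤ p x y)
    (hpb : ∀ x y, p x y ≤ b) {M : ℝ≥0∞} (hM : M ≠ ⊤) {w : ℕ → Euc N → ℝ}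
    (hw : ∀ n, Measurable (w n)) (hw0 : ∀ n, ∀ᵐ x, x ∉ Ω → w n x = 0)
    (hwM : ∀ n, ∫⁻ x, ∫⁻ y, ENNReal.ofReal (gagliardo s p (w n) x y) ≤ M) :
    ∃ (φ : ℕ → ℕ) (u : Euc N → ℝ), StrictMono φ ∧ Measurable u ∧
      ∀ᵐ x, Tendsto (fun n => w (φ n) x) atTop (𝓝 (u x)) := by
  obtain ⟨A, B, hA, hB, hAB⟩ := exists_lintegral_enorm_le (a := 1) hN hΩ hbdd hs.le le_rfl hap hpb
  set K := A + B * M with hK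
  have hKt : K ≠ ⊤ := ENNReal.add_ne_top.2 ⟨hA, ENNReal.mul_ne_top hB hM⟩
  have hwK : ∀ n, ∫⁻ x, ‖w n x‖ₑ ≤ K := fun n => (hAB _ (hw0 n)).trans (by
    rw [hK]; gcongr; exact hwM n)
  have hwi : ∀ n, Integrable (w n) := fun n =>
    ⟨(hw n).aestronglyMeasurable, (hwK n).trans_lt hKt.lt_top⟩
  have hF := fun m : ℕ => exists_finset_lintegral_enorm_sub_le hΩ hbdd hs hap hM
    (κ := ((m : ℝ≥0∞) + 1)⁻¹) (by simp)
  choose F hF using hF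
  let A' : ℕ → (Σ m, F m) → ℝ := fun n i => ∫ x in (i.2 : Set (Euc N)), w n x
  have hA' : ∀ n, A' n ∈ Set.pi univ fun _ : (Σ m, F m) => Icc (-K.toReal) K.toReal := by
    intro n i _
    rw [mem_Icc, ← abs_le, ← Real.norm_eq_abs, ← toReal_enorm]
    refine ENNReal.toReal_mono hKt ((enorm_integral_le_lintegral_enorm _).trans ?_)
    exact (setLIntegral_le_lintegral _ _).trans (hwK n)
  -- Tychonoff replaces the diagonal argument; the index type is countable, so compactness of the
  -- product is sequential.
  obtain ⟨α, -, φ, hφ, hα⟩ := (isCompact_univ_pi fun _ => isCompact_Icc).tendsto_subseq hA'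
  have hα' : ∀ i, Tendsto (fun n => A' (φ n) i) atTop (𝓝 (α i)) := fun i =>
    ((continuous_apply i).tendsto α).comp hα
  let f : ℕ → (Euc N →₁[volume] ℝ) := fun n => (hwi (φ n)).toL1 (w (φ n))
  have hcauchy : CauchySeq f := by
    rw [EMetric.cauchySeq_iff]
    intro κ hκ
    obtain ⟨m, hm⟩ : ∃ m : ℕ, ((m : ℝ≥0∞) + 1)⁻¹ < κ / 2 := by
      obtain ⟨m, hm⟩ := ENNReal.exists_inv_nat_lt (ENNReal.half_pos hκ.ne').ne'
      exact ⟨m, lt_of_le_of_lt (ENNReal.inv_le_inv.2 le_self_add) hm⟩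
    have h1 : Tendsto (fun z : ℕ × ℕ => ∑ E : F m, edist (A' (φ z.1) ⟨m, E⟩) (A' (φ z.2) ⟨m, E⟩))
        atTop (𝓝 0) := by
      rw [← Finset.sum_const_zero (s := (Finset.univ : Finset (F m)))]
      refine tendsto_finsetSum _ fun E _ => ?_
      rw [← prod_atTop_atTop_eq, ← edist_self (α ⟨m, E⟩)]
      exact ((hα' _).comp tendsto_fst).edist ((hα' _).comp tendsto_snd)
    obtain ⟨⟨n₁, n₂⟩, hn⟩ :=
      eventually_atTop.1 (h1.eventually_lt_const (ENNReal.half_pos hκ.ne'))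
    refine ⟨max n₁ n₂, fun i hi j hj => ?_⟩
    have h2 := hn (i, j) ⟨(le_max_left _ _).trans hi, (le_max_right _ _).trans hj⟩
    have h3 := hF m _ _ (hw (φ i)) (hw (φ j)) (hwi _) (hwi _) (hw0 _) (hw0 _) (hwM _) (hwM _)
    rw [← Finset.sum_coe_sort] at h3
    simp only [A', edist_eq_enorm_sub] at h2
    calc edist (f i) (f j) = ∫⁻ x, ‖w (φ i) x - w (φ j) x‖ₑ := by
          simp only [f]
          rw [Integrable.edist_toL1_toL1]
          simp only [edist_eq_enorm_sub]
      _ ≤ _ := h3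
      _ < κ / 2 + κ / 2 := ENNReal.add_lt_add hm h2
      _ = κ := ENNReal.add_halves κ
  obtain ⟨g, hg⟩ := cauchySeq_tendsto_of_complete hcauchy
  obtain ⟨ψ, hψ, hψg⟩ := (tendstoInMeasure_of_tendsto_Lp hg).exists_seq_tendsto_ae
  refine ⟨φ ∘ ψ, g, hφ.comp hψ, (Lp.stronglyMeasurable g).measurable, ?_⟩
  have h2 : ∀ᵐ x, ∀ n, f (ψ n) x = w (φ (ψ n)) x :=
    ae_all_iff.2 fun n => (hwi _).coeFn_toL1
  filter_upwards [hψg, h2] with x h3 h4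
  simpa only [h4, Function.comp_apply] using h3

end Compactness

/-! ### Fatou's lemma for single and iterated integrals. -/

section Fatou

variable {α : Type*} [MeasurableSpace α] {μ : Measure α}

theorem lintegral_le_of_ae_tendsto {f : ℕ → α → ℝ≥0∞} {g : α → ℝ≥0∞} {C : ℝ≥0∞}
    (hf : ∀ n, Measurable (f n)) (hlim : ∀ᵐ x ∂μ, Tendsto (fun n => f n x) atTop (𝓝 (g x)))
    (hC : ∀ᶠ n in atTop, ∫⁻ x, f n x ∂μ ≤ C) : ∫⁻ x, g x ∂μ ≤ C :=
  calc ∫⁻ x, g x ∂μ = ∫⁻ x, liminf (fun n => f n x) atTop ∂μ :=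
        lintegral_congr_ae (hlim.mono fun _ h => h.liminf_eq.symm)
    _ ≤ liminf (fun n => ∫⁻ x, f n x ∂μ) atTop := lintegral_liminf_le hf
    _ ≤ C := by
        refine liminf_le_of_frequently_le' hC.frequently

theorem lintegral_lintegral_le_of_ae_tendsto [SFinite μ] {f : ℕ → α → α → ℝ≥0∞}
    {g : α → α → ℝ≥0∞} {C : ℝ≥0∞} (hf : ∀ n, Measurable (Function.uncurry (f n)))
    (hlim : ∀ᵐ x ∂μ, ∀ᵐ y ∂μ, Tendsto (fun n => f n x y) atTop (𝓝 (g x y)))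
    (hC : ∀ᶠ n in atTop, ∫⁻ x, ∫⁻ y, f n x y ∂μ ∂μ ≤ C) : ∫⁻ x, ∫⁻ y, g x y ∂μ ∂μ ≤ C :=
  calc ∫⁻ x, ∫⁻ y, g x y ∂μ ∂μ ≤ ∫⁻ x, liminf (fun n => ∫⁻ y, f n x y ∂μ) atTop ∂μ := by
        refine lintegral_mono_ae ?_
        filter_upwards [hlim] with x hx
        calc ∫⁻ y, g x y ∂μ = ∫⁻ y, liminf (fun n => f n x y) atTop ∂μ :=
              lintegral_congr_ae (hx.mono fun _ h => h.liminf_eq.symm)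
          _ ≤ _ := lintegral_liminf_le fun n => (hf n).of_uncurry_left
    _ ≤ liminf (fun n => ∫⁻ x, ∫⁻ y, f n x y ∂μ ∂μ) atTop :=
        lintegral_liminf_le fun n => (hf n).lintegral_prod_right'
    _ ≤ C := by
        refine liminf_le_of_frequently_le' hC.frequently

end Fatou

/-! ### Passing to the limit in the two modulars. -/

section Limits

variable {N : ℕ} {s a b : ℝ} {p : Euc N → Euc N → ℝ} {Ω : Set (Euc N)}

theorem fracModular_le_of_ae_tendsto (hp : Continuous (fun z : Euc N × Euc N => p z.1 z.2))
    (hp0 : ∀ x y, 0 < p x y) {w : ℕ → Euc N → ℝ} {u : Euc N → ℝ} (hw : ∀ n, Measurable (w n))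
    (hlim : ∀ᵐ x, Tendsto (fun n => w n x) atTop (𝓝 (u x))) {C : ℝ≥0∞}
    (hC : ∀ᶠ n in atTop, fracModular s p (w n) ≤ C) : fracModular s p u ≤ C := by
  refine lintegral_lintegral_le_of_ae_tendsto
    (f := fun n x y => ENNReal.ofReal
      (|w n x - w n y| ^ p x y / ‖x - y‖ ^ ((N : ℝ) + s * p x y) / p x y)) ?_ ?_ hC
  · intro n
    exact ((measurable_gagliardo hp (hw n)).div hp.measurable).ennreal_ofReal
  · filter_upwards [hlim] with x hx
    filter_upwards [hlim] with y hy
    exact ENNReal.tendsto_ofReal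
      ((((hx.sub hy).abs.rpow_const (Or.inr (hp0 x y).le)).div_const _).div_const _)

/-- Fatou gives `≤ 1`. For `≥ 1`, truncate at height `T`: the part of `w n` above `T` carries
modular at most `κ` uniformly in `n`, and the truncated modulars converge by domination on the
bounded set `Ω`. -/
theorem lebesgueModular_eq_one_of_ae_tendsto (hN : 0 < N) (hΩ : MeasurableSet Ω)
    (hbdd : Bornology.IsBounded Ω) (hs : s ∈ Ioo (0 : ℝ) 1) (ha : 1 ≤ a) (hap : ∀ x y, a ≤ p x y)
    (hpb : ∀ x y, p x y ≤ b) (hp : Continuous (fun z : Euc N × Euc N => p z.1 z.2))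
    {M : ℝ≥0∞} (hM : M ≠ ⊤) {w : ℕ → Euc N → ℝ} {u : Euc N → ℝ}
    (hw : ∀ n, Measurable (w n)) (hw0 : ∀ n, ∀ᵐ x, x ∉ Ω → w n x = 0)
    (hwM : ∀ n, ∫⁻ x, ∫⁻ y, ENNReal.ofReal (gagliardo s p (w n) x y) ≤ M)
    (hlim : ∀ᵐ x, Tendsto (fun n => w n x) atTop (𝓝 (u x)))
    (hw1 : ∀ n, lebesgueModular Ω (fun x => p x x) (w n) = 1) :
    lebesgueModular Ω (fun x => p x x) u = 1 := by
  have hpm : Measurable fun x => p x x := (hp.comp (continuous_id.prodMk continuous_id)).measurable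
  have hp1 : ∀ x, 1 ≤ p x x := fun x => ha.trans (hap x x)
  apply le_antisymm
  · refine lintegral_le_of_ae_tendsto (f := fun n x => ENNReal.ofReal (|w n x| ^ p x x / p x x))
      (fun n => by have := hw n; fun_prop) ?_ (Eventually.of_forall fun n => (hw1 n).le)
    refine ae_restrict_of_ae ?_
    filter_upwards [hlim] with x hx
    exact ENNReal.tendsto_ofReal
      ((hx.abs.rpow_const (Or.inr (by linarith [hp1 x]))).div_const _)
  · obtain ⟨A, B, hA, hB, hAB⟩ := exists_lintegral_enorm_le hN hΩ hbdd hs.1.le ha hap hpb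
    have hKt : A + B * M ≠ ⊤ := ENNReal.add_ne_top.2 ⟨hA, ENNReal.mul_ne_top hB hM⟩
    refine ENNReal.le_of_forall_pos_le_add fun κ hκ _ => ?_
    obtain ⟨T, hT0, hT⟩ := exists_setLIntegral_rpow_le hN hΩ hbdd hs ha hap hpb hp hKt hM
      (κ := κ) (by exact_mod_cast hκ)
    let g : (Euc N → ℝ) → Euc N → ℝ≥0∞ :=
      fun v x => ENNReal.ofReal (min |v x| T ^ p x x / p x x)
    have hsplit : ∀ n, 1 ≤ κ + ∫⁻ x in Ω, g (w n) x := by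
      intro n
      have hS : MeasurableSet {x | T ≤ |w n x|} :=
        measurableSet_le measurable_const (by have := hw n; fun_prop)
      have h1 : ∫⁻ x in Ω ∩ {x | T ≤ |w n x|}, ENNReal.ofReal (|w n x| ^ p x x) ≤ κ :=
        hT _ (hw n) ((hAB _ (hw0 n)).trans (by gcongr; exact hwM n)) (hwM n)
      rw [← hw1 n]
      unfold lebesgueModular
      rw [← lintegral_inter_add_sdiff _ Ω hS]
      refine add_le_add (le_trans ?_ h1) ?_
      · refine lintegral_mono fun x => ENNReal.ofReal_le_ofReal ?_
        exact div_le_self (by positivity) (hp1 x)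
      · calc _ ≤ ∫⁻ x in Ω \ {x | T ≤ |w n x|}, g (w n) x := by
              refine setLIntegral_mono' (hΩ.diff hS) fun x hx => ?_
              have h2 : |w n x| ≤ T := (not_le.1 hx.2).le
              simp only [g, min_eq_left h2, le_refl]
          _ ≤ _ := lintegral_mono_set sdiff_subset
    have hconv : Tendsto (fun n => ∫⁻ x in Ω, g (w n) x) atTop (𝓝 (∫⁻ x in Ω, g u x)) := by
      refine tendsto_lintegral_of_dominated_convergence
        (fun _ => ENNReal.ofReal (max T 1 ^ b)) ?_ ?_ ?_ ?_
      · intro n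
        have := hw n
        fun_prop
      · refine fun n => Eventually.of_forall fun x => ENNReal.ofReal_le_ofReal ?_
        have h3 : 0 ≤ min |w n x| T := le_min (abs_nonneg _) hT0.le
        have hp1x := hp1 x
        calc min |w n x| T ^ p x x / p x x ≤ min |w n x| T ^ p x x :=
              div_le_self (by positivity) (hp1 x)
          _ ≤ max T 1 ^ p x x := by
              gcongr
              exact (min_le_right _ _).trans (le_max_left _ _)
          _ ≤ max T 1 ^ b := Real.rpow_le_rpow_of_exponent_le (le_max_right _ _) (hpb x x)
      · rw [setLIntegral_const]
        exact ENNReal.mul_ne_top ENNReal.ofReal_ne_top hbdd.measure_lt_top.ne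
      · refine ae_restrict_of_ae ?_
        filter_upwards [hlim] with x hx
        exact ENNReal.tendsto_ofReal (((hx.abs.min tendsto_const_nhds).rpow_const
          (Or.inr (by linarith [hp1 x]))).div_const _)
    have h4 : 1 ≤ κ + ∫⁻ x in Ω, g u x :=
      ge_of_tendsto' (tendsto_const_nhds.add hconv) hsplit
    refine h4.trans ?_
    rw [add_comm]
    gcongr
    refine lintegral_mono fun x => ENNReal.ofReal_le_ofReal ?_
    have h3 : 0 ≤ min |u x| T := le_min (abs_nonneg _) hT0.le
    have hp1x := hp1 x
    gcongr
    exact min_le_left _ _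

end Limits

/-! ### A nonzero element of `X`. -/

section Bump

variable {N : ℕ} {s a b : ℝ} {p : Euc N → Euc N → ℝ} {Ω : Set (Euc N)}

/-- A translation-invariant majorant of the energy density of bounded Lipschitz functions. -/
noncomputable def lipKernel (N : ℕ) (s a : ℝ) (z : Euc N) : ℝ≥0∞ :=
  (Metric.ball 0 1).indicator (fun z => ENNReal.ofReal (‖z‖ ^ (-((N : ℝ) - (1 - s) * a)))) z +
    ENNReal.ofReal (2 ^ ((N : ℝ) + s * a) * (1 + ‖z‖) ^ (-((N : ℝ) + s * a)))

theorem measurable_lipKernel : Measurable (lipKernel N s a) := by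
  unfold lipKernel
  refine Measurable.add (Measurable.indicator ?_ measurableSet_ball) ?_ <;> fun_prop

theorem lintegral_lipKernel_ne_top (hN : 0 < N) (hs : s ∈ Ioo (0 : ℝ) 1) (ha : 0 < a) :
    ∫⁻ z, lipKernel N s a z ≠ ⊤ := by
  have hs0 := hs.1
  have hs1 := hs.2
  unfold lipKernel
  rw [lintegral_add_right _ (by fun_prop), lintegral_indicator measurableSet_ball]
  refine ENNReal.add_ne_top.2 ⟨?_, ?_⟩
  · have h := integrableOn_ball_of_norm_le_rpow (E := Euc N) (μ := volume) (C := 1) (r := 1)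
      (α := (N : ℝ) - (1 - s) * a) (f := fun z : Euc N => ‖z‖ ^ (-((N : ℝ) - (1 - s) * a)))
      (by rw [finrank_euclideanSpace_fin]; exact hN)
      (by rw [finrank_euclideanSpace_fin]; nlinarith)
      (Eventually.of_forall fun z => by
        rw [one_mul, Real.norm_of_nonneg (by positivity)])
      (by have : Measurable fun z : Euc N => ‖z‖ ^ (-((N : ℝ) - (1 - s) * a)) := by fun_prop
          exact this.aestronglyMeasurable)
    exact h.lintegral_lt_top.ne
  · have h : Integrable (fun z : Euc N => (2 : ℝ) ^ ((N : ℝ) + s * a) *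
        (1 + ‖z‖) ^ (-((N : ℝ) + s * a))) :=
      (integrable_one_add_norm (by
        rw [finrank_euclideanSpace_fin]; nlinarith)).const_mul _
    exact h.lintegral_lt_top.ne

/-- Near the diagonal the Lipschitz bound leaves the exponent `(1 - s) * p x y - N ≥ (1 - s) * a -
N`. At distance at least 1, boundedness leaves decay of order `N + s * a`, and `1 + ‖z‖ ≤ 2 * ‖z‖`.
-/
theorem gagliardo_le_lipKernel (hs : s ∈ Ioo (0 : ℝ) 1) (ha : 0 < a) {v : Euc N → ℝ} {x y : Euc N}
    (hap : a ≤ p x y) (hv : |v x - v y| ≤ ‖x - y‖) (hv1 : |v x - v y| ≤ 1) :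
    ENNReal.ofReal (gagliardo s p v x y) ≤ lipKernel N s a (x - y) := by
  have hs0 := hs.1
  have hs1 : 0 ≤ 1 - s := by linarith [hs.2]
  have hp0 : 0 < p x y := ha.trans_le hap
  unfold lipKernel
  rcases eq_or_ne x y with rfl | hne
  · simp [gagliardo, Real.zero_rpow hp0.ne']
  have hpos : 0 < ‖x - y‖ := norm_pos_iff.2 (sub_ne_zero.2 hne)
  rcases lt_or_ge ‖x - y‖ 1 with hlt | hge
  · refine le_trans ?_ le_self_add
    rw [indicator_of_mem (by simpa using hlt)]
    apply ENNReal.ofReal_le_ofReal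
    unfold gagliardo
    calc |v x - v y| ^ p x y / ‖x - y‖ ^ ((N : ℝ) + s * p x y)
        ≤ ‖x - y‖ ^ p x y / ‖x - y‖ ^ ((N : ℝ) + s * p x y) := by gcongr
      _ = ‖x - y‖ ^ (p x y - ((N : ℝ) + s * p x y)) := (Real.rpow_sub hpos _ _).symm
      _ ≤ _ := by
          apply Real.rpow_le_rpow_of_exponent_ge hpos hlt.le
          nlinarith
  · refine le_trans ?_ le_add_self
    apply ENNReal.ofReal_le_ofReal
    unfold gagliardo
    have he : 0 < (N : ℝ) + s * a := by positivity
    calc |v x - v y| ^ p x y / ‖x - y‖ ^ ((N : ℝ) + s * p x y)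
        ≤ 1 / ‖x - y‖ ^ ((N : ℝ) + s * a) := by
          apply div_le_div₀ zero_le_one (Real.rpow_le_one (abs_nonneg _) hv1 hp0.le)
            (by positivity)
          gcongr
      _ = (2 : ℝ) ^ ((N : ℝ) + s * a) * (2 * ‖x - y‖) ^ (-((N : ℝ) + s * a)) := by
          rw [Real.rpow_neg (by positivity), Real.mul_rpow (by norm_num) hpos.le]
          field_simp
      _ ≤ _ := by
          rw [Real.rpow_neg (by positivity), Real.rpow_neg (by positivity)]
          gcongr
          linarith

/-- The density vanishes unless `x` or `y` lies in `B`; by translation invariance each case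
contributes at most `volume B` times the integral of the kernel. -/
theorem lintegral_gagliardo_ne_top_of_lipschitz (hN : 0 < N) (hs : s ∈ Ioo (0 : ℝ) 1) (ha : 0 < a)
    (hap : ∀ x y, a ≤ p x y) {v : Euc N → ℝ} {B : Set (Euc N)} (hB : MeasurableSet B)
    (hBfin : volume B ≠ ⊤) (hvB : ∀ x ∉ B, v x = 0) (hv : ∀ x y, |v x - v y| ≤ ‖x - y‖)
    (hv1 : ∀ x y, |v x - v y| ≤ 1) :
    ∫⁻ x, ∫⁻ y, ENNReal.ofReal (gagliardo s p v x y) ≠ ⊤ := by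
  set κ := ∫⁻ z, lipKernel N s a z with hκ
  have hκt : κ ≠ ⊤ := lintegral_lipKernel_ne_top hN hs ha
  have hmk : Measurable (fun z : Euc N × Euc N => lipKernel N s a (z.1 - z.2)) :=
    measurable_lipKernel.comp (measurable_fst.sub measurable_snd)
  let f : Euc N → Euc N → ℝ≥0∞ := fun x y => B.indicator 1 x * lipKernel N s a (x - y)
  let g : Euc N → Euc N → ℝ≥0∞ := fun x y => B.indicator 1 y * lipKernel N s a (x - y)
  have hone : Measurable (B.indicator (1 : Euc N → ℝ≥0∞)) := measurable_one.indicator hB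
  have hone_top : ∀ x, B.indicator (1 : Euc N → ℝ≥0∞) x ≠ ⊤ := fun x => by
    by_cases hx : x ∈ B <;> simp [hx]
  have hf : Measurable (Function.uncurry f) := (hone.comp measurable_fst).mul hmk
  have hg : Measurable (Function.uncurry g) := (hone.comp measurable_snd).mul hmk
  have hle : ∀ x y, ENNReal.ofReal (gagliardo s p v x y) ≤ f x y + g x y := by
    intro x y
    have h1 := gagliardo_le_lipKernel (s := s) (p := p) hs ha (hap x y) (hv x y) (hv1 x y)
    by_cases hx : x ∈ B
    · refine le_trans h1 (le_trans ?_ le_self_add)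
      simp [f, hx]
    by_cases hy : y ∈ B
    · refine le_trans h1 (le_trans ?_ le_add_self)
      simp [g, hy]
    · have h0 : gagliardo s p v x y = 0 := by
        unfold gagliardo
        rw [hvB x hx, hvB y hy, sub_zero, abs_zero, Real.zero_rpow (ha.trans_le (hap x y)).ne',
          zero_div]
      rw [h0, ENNReal.ofReal_zero]
      exact zero_le
  have hfi : ∫⁻ x, ∫⁻ y, f x y = volume B * κ := by
    have h1 : ∀ x, ∫⁻ y, f x y = B.indicator 1 x * κ := by
      intro x
      simp only [f]
      rw [lintegral_const_mul' _ _ (hone_top x),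
        lintegral_sub_left_eq_self (lipKernel N s a) x]
    simp only [h1]
    rw [lintegral_mul_const _ hone, lintegral_indicator_one hB]
  have hgi : ∫⁻ x, ∫⁻ y, g x y = volume B * κ := by
    rw [lintegral_lintegral_swap hg.aemeasurable]
    have h1 : ∀ y, ∫⁻ x, g x y = B.indicator 1 y * κ := by
      intro y
      simp only [g]
      rw [lintegral_const_mul' _ _ (hone_top y),
        lintegral_sub_right_eq_self (lipKernel N s a) y]
    simp only [h1]
    rw [lintegral_mul_const _ hone, lintegral_indicator_one hB]
  refine ne_top_of_le_ne_top (b := volume B * κ + volume B * κ) ?_ ?_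
  · have := ENNReal.mul_ne_top hBfin hκt
    exact ENNReal.add_ne_top.2 ⟨this, this⟩
  · calc _ ≤ ∫⁻ x, ∫⁻ y, (f x y + g x y) :=
          lintegral_mono fun x => lintegral_mono fun y => hle x y
      _ = ∫⁻ x, ((∫⁻ y, f x y) + ∫⁻ y, g x y) :=
          lintegral_congr fun x => lintegral_add_left hf.of_uncurry_left _
      _ = (∫⁻ x, ∫⁻ y, f x y) + ∫⁻ x, ∫⁻ y, g x y :=
          lintegral_add_left hf.lintegral_prod_right' _
      _ = _ := by rw [hfi, hgi]
      _ ≤ _ := le_rfl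

theorem mk_mem_X {Ω : Set (Euc N)} {v : Euc N → ℝ} (hv : Measurable v)
    (h1 : ∫⁻ x, ENNReal.ofReal (|v x| ^ p x x) < ⊤)
    (h2 : ∫⁻ x, ∫⁻ y, ENNReal.ofReal (gagliardo s p v x y) < ⊤)
    (h3 : ∀ᵐ x, x ∉ Ω → v x = 0) :
    AEEqFun.mk v hv.aestronglyMeasurable ∈ X Ω s p := by
  have hae := AEEqFun.coeFn_mk v (hv.aestronglyMeasurable (μ := volume))
  refine ⟨⟨?_, ?_⟩, ?_⟩
  · refine lt_of_eq_of_lt (lintegral_congr_ae ?_) h1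
    filter_upwards [hae] with x hx
    rw [hx]
  · exact lt_of_eq_of_lt (lintegral_lintegral_congr_of_ae
      (F := fun α β x y => ENNReal.ofReal (|α - β| ^ p x y / ‖x - y‖ ^ ((N : ℝ) + s * p x y)))
      hae) h2
  · filter_upwards [hae, h3] with x hx h
    rw [hx]
    exact h

/-- A tent function on a small ball. Without a competitor, `Lambda1` would be the infimum of the
empty set, which is 0 by convention. -/
theorem X_sdiff_zero_nonempty (hN : 0 < N) (hΩ : IsOpen Ω) (hΩne : Ω.Nonempty)
    (hs : s ∈ Ioo (0 : ℝ) 1) (ha : 0 < a) (hap : ∀ x y, a ≤ p x y) : (X Ω s p \ {0}).Nonempty := by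
  obtain ⟨x₀, hx₀⟩ := hΩne
  obtain ⟨r₁, hr₁, hball⟩ := Metric.isOpen_iff.1 hΩ x₀ hx₀
  set r := min r₁ 1 with hr
  have hr0 : 0 < r := lt_min hr₁ one_pos
  have hr1 : r ≤ 1 := min_le_right _ _
  set B := Metric.ball x₀ r with hBdef
  have hBΩ : B ⊆ Ω := (Metric.ball_subset_ball (min_le_left _ _)).trans hball
  have hBfin : volume B ≠ ⊤ := measure_ball_lt_top.ne
  let v : Euc N → ℝ := fun x => max (r - dist x x₀) 0
  have hvB : ∀ x ∉ B, v x = 0 := fun x hx => by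
    have : r ≤ dist x x₀ := not_lt.1 hx
    exact max_eq_right (by linarith)
  have hv0 : ∀ x, 0 ≤ v x := fun x => le_max_right _ _
  have hvr : ∀ x, v x ≤ 1 := fun x =>
    max_le (by linarith [dist_nonneg (x := x) (y := x₀)]) zero_le_one
  have hvm : Measurable v := by fun_prop
  have hvlip : ∀ x y, |v x - v y| ≤ ‖x - y‖ := fun x y => by
    refine (abs_max_sub_max_le_abs _ _ _).trans ?_
    rw [sub_sub_sub_cancel_left, ← dist_eq_norm, dist_comm x y]
    exact abs_dist_sub_le y x x₀
  have hv1 : ∀ x y, |v x - v y| ≤ 1 := fun x y =>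
    abs_le.2 ⟨by linarith [hv0 x, hvr y], by linarith [hv0 y, hvr x]⟩
  refine ⟨AEEqFun.mk v hvm.aestronglyMeasurable, mk_mem_X hvm ?_ ?_ ?_, ?_⟩
  · refine lt_of_le_of_lt (b := volume B) ?_ hBfin.lt_top
    rw [← lintegral_indicator_one measurableSet_ball]
    refine lintegral_mono fun x => ?_
    have hp0 := ha.trans_le (hap x x)
    by_cases hx : x ∈ B
    · rw [indicator_of_mem hx, Pi.one_apply, ENNReal.ofReal_le_one]
      exact Real.rpow_le_one (abs_nonneg _) (by rw [abs_of_nonneg (hv0 x)]; exact hvr x) hp0.le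
    · simp [hvB x hx, Real.zero_rpow hp0.ne']
  · exact (lintegral_gagliardo_ne_top_of_lipschitz hN hs ha hap measurableSet_ball hBfin hvB
      hvlip hv1).lt_top
  · exact Eventually.of_forall fun x hx => hvB x fun h => hx (hBΩ h)
  · intro h0
    rw [mem_singleton_iff, AEEqFun.zero_def, AEEqFun.mk_eq_mk] at h0
    have h1 : volume B = 0 := by
      refine measure_mono_null (fun x hx => ?_) h0
      have : dist x x₀ < r := hx
      have hpos : 0 < v x := lt_max_of_lt_left (by linarith)
      exact hpos.ne'
    exact (Metric.measure_ball_pos volume x₀ hr0).ne' h1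

end Bump

/-! ### Minimizing sequences, their limits, and positivity. -/

section Minimizer

variable {N : ℕ} {s a b : ℝ} {p : Euc N → Euc N → ℝ} {Ω : Set (Euc N)}

theorem rayleigh_nonneg (u : Euc N →ₘ[(volume : Measure (Euc N))] ℝ) : 0 ≤ rayleigh Ω s p u :=
  div_nonneg (Real.sInf_nonneg fun _ h => h.1.le) (Real.sInf_nonneg fun _ h => h.1.le)

theorem rayleigh_mk {u : Euc N → ℝ} (hu : AEStronglyMeasurable u volume) :
    rayleigh Ω s p (AEEqFun.mk u hu) =
      fracSeminorm s p u / luxNorm Ω (fun x => p x x) u := by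
  have hae : ∀ c : ℝ, (fun x => AEEqFun.mk u hu x / c) =ᵐ[volume] fun x => u x / c := fun c => by
    filter_upwards [AEEqFun.coeFn_mk u hu] with x hx
    rw [hx]
  simp only [rayleigh, fracSeminorm, luxNorm, fun c => fracModular_congr (s := s) (p := p) (hae c),
    fun c => lebesgueModular_congr Ω (fun x => p x x) (hae c)]

theorem lebesgueModular_ne_top (hp : ∀ x, 1 ≤ p x x) {u : Euc N → ℝ}
    (hu : ∫⁻ x, ENNReal.ofReal (|u x| ^ p x x) < ⊤) :
    lebesgueModular Ω (fun x => p x x) u ≠ ⊤ := by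
  refine ne_top_of_le_ne_top hu.ne ((lintegral_mono fun x => ?_).trans
    (setLIntegral_le_lintegral Ω _))
  exact ENNReal.ofReal_le_ofReal (div_le_self (by positivity) (hp x))

theorem ae_eq_zero_of_lebesgueModular_eq_zero (hΩ : MeasurableSet Ω) (hp : ∀ x, 0 < p x x)
    (hpm : Measurable fun x => p x x) {u : Euc N → ℝ} (hu : Measurable u)
    (hu0 : ∀ᵐ x, x ∉ Ω → u x = 0) (h : lebesgueModular Ω (fun x => p x x) u = 0) :
    ∀ᵐ x, u x = 0 := by
  unfold lebesgueModular at h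
  have hm : Measurable fun x => ENNReal.ofReal (|u x| ^ p x x / p x x) :=
    ((hu.abs.pow hpm).div hpm).ennreal_ofReal
  rw [lintegral_eq_zero_iff hm] at h
  have h1 := (ae_restrict_iff' hΩ).1 h
  filter_upwards [h1, hu0] with x hx hx0
  by_cases hxΩ : x ∈ Ω
  · have h2 := hx hxΩ
    rw [Pi.zero_apply, ENNReal.ofReal_eq_zero, div_le_iff₀ (hp x), zero_mul] at h2
    by_contra hne
    exact absurd (Real.rpow_pos_of_pos (abs_pos.2 hne) (p x x)) (not_lt.2 h2)
  · exact hx0 hxΩ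

theorem fracModular_abs_le (hp0 : ∀ x y, 0 < p x y) (u : Euc N → ℝ) {c : ℝ} (hc : 0 < c) :
    fracModular s p (fun x => |u x| / c) ≤ fracModular s p (fun x => u x / c) := by
  refine lintegral_mono fun x => lintegral_mono fun y => ENNReal.ofReal_le_ofReal ?_
  have hp := hp0 x y
  dsimp only
  rw [← sub_div, ← sub_div, abs_div, abs_div _ c]
  have h := abs_abs_sub_abs_le (u x) (u y)
  gcongr

/-- A sequence of functions with normalized Lebesgue modular and fractional seminorms tending to
`Λ` yields a nonnegative limit function with seminorm at most `Λ`. -/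
theorem exists_nonneg_limit (hN : 0 < N) (hΩ : MeasurableSet Ω)
    (hbdd : Bornology.IsBounded Ω) (hs : s ∈ Ioo (0 : ℝ) 1) (ha : 1 ≤ a) (hap : ∀ x y, a ≤ p x y)
    (hpb : ∀ x y, p x y ≤ b) (hp : Continuous (fun z : Euc N × Euc N => p z.1 z.2))
    {w : ℕ → Euc N → ℝ} {c : ℕ → ℝ} {Λ : ℝ} (hc0 : ∀ n, 0 < c n) (hc : Tendsto c atTop (𝓝 Λ))
    (hw : ∀ n, Measurable (w n)) (hw0 : ∀ n, ∀ᵐ x, x ∉ Ω → w n x = 0)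
    (hw1 : ∀ n, lebesgueModular Ω (fun x => p x x) (w n) = 1)
    (hwc : ∀ n, fracModular s p (fun x => w n x / c n) ≤ 1) :
    ∃ u : Euc N → ℝ, Measurable u ∧ (∀ x, 0 ≤ u x) ∧ (∀ᵐ x, x ∉ Ω → u x = 0) ∧
      lebesgueModular Ω (fun x => p x x) u = 1 ∧
      ∀ d > Λ, fracModular s p (fun x => u x / d) ≤ 1 := by
  have ha0 : 0 < a := by linarith
  have hp0 : ∀ x y, 0 < p x y := fun x y => ha0.trans_le (hap x y)
  have hΛ0 : 0 ≤ Λ := ge_of_tendsto' hc fun n => (hc0 n).le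
  obtain ⟨C₀, hC₀⟩ := hc.bddAbove_range
  set C := max C₀ 1 with hC
  have hC1 : 1 ≤ C := le_max_right _ _
  have hcC : ∀ n, c n ≤ C := fun n => (hC₀ ⟨n, rfl⟩).trans (le_max_left _ _)
  set M := ENNReal.ofReal b * ENNReal.ofReal (C ^ b) with hM
  have hMt : M ≠ ⊤ := ENNReal.mul_ne_top ENNReal.ofReal_ne_top ENNReal.ofReal_ne_top
  -- Since `C ≥ c n`, the modular of `w n / C` is at most 1; undoing the division costs `C ^ b`, and
  -- removing the weight `1 / p` costs `b`.
  have hwM : ∀ n, ∫⁻ x, ∫⁻ y, ENNReal.ofReal (gagliardo s p (w n) x y) ≤ M := by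
    intro n
    refine (gagliardo_le_fracModular ha0 hap hpb (w n)).trans ?_
    rw [hM]
    gcongr
    have hsc := fracModular_scaling (s := s) ha0 hap hpb (w n)
    have h1 := hsc.up 1 one_pos C hC1
    simp only [div_one, mul_one] at h1
    refine h1.trans ((mul_le_mul_right ((hsc.antitone (hc0 n) (hcC n)).trans (hwc n)) _).trans ?_)
    rw [mul_one]
  obtain ⟨φ, u, hφ, hu, hlim⟩ := exists_subseq_tendsto_ae hN hΩ hbdd hs.1
    (fun x y => ha.trans (hap x y)) hpb hMt hw hw0 hwM
  refine ⟨fun x => |u x|, by fun_prop, fun x => abs_nonneg _, ?_, ?_, ?_⟩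
  · filter_upwards [hlim, ae_all_iff.2 hw0] with x hx hx0 hxΩ
    have h1 : (fun n => w (φ n) x) = fun _ => 0 := funext fun n => hx0 _ hxΩ
    rw [h1] at hx
    rw [tendsto_nhds_unique hx tendsto_const_nhds, abs_zero]
  · have h1 := lebesgueModular_eq_one_of_ae_tendsto hN hΩ hbdd hs ha hap hpb hp hMt
      (fun n => hw (φ n)) (fun n => hw0 (φ n)) (fun n => hwM (φ n)) hlim (fun n => hw1 (φ n))
    simpa only [lebesgueModular, abs_abs] using h1
  · intro d hd
    have hd0 : 0 < d := hΛ0.trans_lt hd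
    refine (fracModular_abs_le hp0 u hd0).trans ?_
    refine fracModular_le_of_ae_tendsto hp hp0 (w := fun n x => w (φ n) x / d)
      (fun n => (hw (φ n)).div_const d) ?_ ?_
    · filter_upwards [hlim] with x hx
      exact hx.div_const d
    -- Fixing `d > Λ` avoids dividing by `c n`, whose limit is not yet known to be positive.
    · filter_upwards [(hc.comp hφ.tendsto_atTop).eventually_lt_const hd] with n hn
      exact ((fracModular_scaling ha0 hap hpb (w (φ n))).antitone (hc0 _) hn.le).trans (hwc _)

/-- All `u / d` have energy at most `b`, hence `L¹` norm at most a common `K`. So `u` has `L¹` norm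
at most `d * K` for every `d > 0`. -/
theorem ae_eq_zero_of_forall_fracModular_le_one (hN : 0 < N) (hΩ : MeasurableSet Ω)
    (hbdd : Bornology.IsBounded Ω) (hs : 0 ≤ s) (ha : 1 ≤ a) (hap : ∀ x y, a ≤ p x y)
    (hpb : ∀ x y, p x y ≤ b) {u : Euc N → ℝ} (hu : Measurable u)
    (hu0 : ∀ᵐ x, x ∉ Ω → u x = 0) (h : ∀ d > 0, fracModular s p (fun x => u x / d) ≤ 1) :
    ∀ᵐ x, u x = 0 := by
  obtain ⟨A, B, hA, hB, hAB⟩ := exists_lintegral_enorm_le hN hΩ hbdd hs ha hap hpb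
  set K := A + B * (ENNReal.ofReal b * 1) with hK
  have hKt : K ≠ ⊤ := ENNReal.add_ne_top.2
    ⟨hA, ENNReal.mul_ne_top hB (ENNReal.mul_ne_top ENNReal.ofReal_ne_top ENNReal.one_ne_top)⟩
  have h1 : ∀ d > 0, ∫⁻ x, ‖u x‖ₑ ≤ ENNReal.ofReal d * K := by
    intro d hd
    have h2 : ∫⁻ x, ‖u x / d‖ₑ ≤ K := by
      refine (hAB _ ?_).trans ?_
      · filter_upwards [hu0] with x hx hxΩ
        rw [hx hxΩ, zero_div]
      · rw [hK]
        gcongr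
        refine (gagliardo_le_fracModular (by linarith) hap hpb _).trans ?_
        gcongr
        exact h d hd
    calc ∫⁻ x, ‖u x‖ₑ = ENNReal.ofReal d * ∫⁻ x, ‖u x / d‖ₑ := by
          rw [← lintegral_const_mul' _ _ ENNReal.ofReal_ne_top]
          refine lintegral_congr fun x => ?_
          rw [← Real.enorm_eq_ofReal hd.le, ← enorm_mul, mul_div_cancel₀ _ hd.ne']
      _ ≤ _ := by gcongr
  have h3 : Tendsto (fun d : ℝ => ENNReal.ofReal d * K) (𝓝[>] 0) (𝓝 0) := by
    have h4 : Tendsto (fun d : ℝ => ENNReal.ofReal d) (𝓝[>] 0) (𝓝 0) := by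
      simpa using (ENNReal.continuous_ofReal.tendsto (0 : ℝ)).mono_left
        (nhdsWithin_le_nhds (s := Ioi 0))
    simpa using ENNReal.Tendsto.mul_const h4 (Or.inr hKt)
  have h5 : ∫⁻ x, ‖u x‖ₑ = 0 := by
    refine le_antisymm (ge_of_tendsto h3 ?_) zero_le
    filter_upwards [self_mem_nhdsWithin] with d hd using h1 d hd
  rw [lintegral_eq_zero_iff hu.enorm] at h5
  filter_upwards [h5] with x hx
  simpa using hx

/-- A normalized minimizing sequence for the Rayleigh quotient. -/
theorem exists_minimizing_sequence (hΩ : MeasurableSet Ω) (ha : 1 ≤ a)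
    (hap : ∀ x y, a ≤ p x y) (hpb : ∀ x y, p x y ≤ b)
    (hp : Continuous (fun z : Euc N × Euc N => p z.1 z.2)) (hne : (X Ω s p \ {0}).Nonempty) :
    ∃ (w : ℕ → Euc N → ℝ) (c : ℕ → ℝ), (∀ n, 0 < c n) ∧ Tendsto c atTop (𝓝 (Lambda1 Ω s p)) ∧
      (∀ n, Measurable (w n)) ∧ (∀ n, ∀ᵐ x, x ∉ Ω → w n x = 0) ∧
      (∀ n, lebesgueModular Ω (fun x => p x x) (w n) = 1) ∧
      ∀ n, fracModular s p (fun x => w n x / c n) ≤ 1 := by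
  have ha0 : 0 < a := by linarith
  have hp1 : ∀ x, 1 ≤ p x x := fun x => ha.trans (hap x x)
  have hpm : Measurable fun x => p x x := (hp.comp (continuous_id.prodMk continuous_id)).measurable
  obtain ⟨r, -, hr, hrS⟩ := exists_seq_tendsto_sInf (hne.image (rayleigh Ω s p))
    ⟨0, by rintro _ ⟨u, -, rfl⟩; exact rayleigh_nonneg u⟩
  choose v hv hvr using hrS
  let L : ℕ → ℝ := fun n => luxNorm Ω (fun x => p x x) (v n)
  have hr0 : ∀ n, 0 ≤ r n := fun n => hvr n ▸ rayleigh_nonneg (v n)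
  have hvm : ∀ n, Measurable (v n) := fun n => (v n).measurable
  have hlsc := fun n => lebesgueModular_scaling Ω ha0 (fun x => hap x x) (fun x => hpb x x) (v n)
  have hfin : ∀ n, lebesgueModular Ω (fun x => p x x) (fun x => v n x / 1) ≠ ⊤ := fun n => by
    simpa only [div_one] using lebesgueModular_ne_top hp1 (hv n).1.1.1
  have hnz : ∀ n, lebesgueModular Ω (fun x => p x x) (fun x => v n x / 1) ≠ 0 := fun n h => by
    simp only [div_one] at h
    have h1 := ae_eq_zero_of_lebesgueModular_eq_zero hΩ (fun x => by linarith [hp1 x]) hpm (hvm n)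
      (hv n).1.2 h
    refine (hv n).2 (AEEqFun.ext ?_)
    filter_upwards [h1, AEEqFun.coeFn_zero (α := Euc N) (β := ℝ) (μ := volume)] with x h2 h3
    rw [h2, h3, Pi.zero_apply]
  have hL0 : ∀ n, 0 < L n := fun n => (hlsc n).sInf_pos (hnz n) (hfin n)
  -- The term `1 / (n + 1)` makes `c n` positive and strictly larger than the seminorm of the
  -- normalized function, so that the modular there is below 1.
  refine ⟨fun n x => v n x / L n, fun n => r n + 1 / ((n : ℝ) + 1), fun n => ?_, ?_,
    fun n => (hvm n).div_const _, fun n => ?_, fun n => ?_, fun n => ?_⟩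
  · have := hr0 n
    positivity
  · simpa [Lambda1] using hr.add tendsto_one_div_add_atTop_nhds_zero_nat
  · filter_upwards [(hv n).1.2] with x hx hxΩ
    rw [hx hxΩ, zero_div]
  · exact (hlsc n).apply_sInf (hnz n) (hfin n)
  · have hfsc := fracModular_scaling (s := s) ha0 hap hpb (v n)
    have h1 : fracModular s p (fun x => v n x / 1) ≠ ⊤ := by
      simp only [div_one]
      exact ne_top_of_le_ne_top (hv n).1.1.2.ne (fracModular_le_gagliardo ha hap _)
    have h2 : fracSeminorm s p (v n) < L n * (r n + 1 / ((n : ℝ) + 1)) := by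
      have h3 : fracSeminorm s p (v n) = r n * L n := by
        rw [← hvr n]
        exact (div_mul_cancel₀ _ (hL0 n).ne').symm
      rw [h3, mul_comm]
      have h4 : 0 < 1 / ((n : ℝ) + 1) := by positivity
      exact mul_lt_mul_of_pos_left (by linarith) (hL0 n)
    simpa only [div_div] using (hfsc.lt_one_of_sInf_lt h1 h2).le

end Minimizer

end FracVarExp

/-! ### The main theorem. -/

open FracVarExp in
theorem mainTheorem9 {N : ℕ} (Ω : Set (FracVarExp.Euc N)) (hΩ_open : IsOpen Ω)
    (hΩ_ne : Ω.Nonempty) (hΩ_bdd : Bornology.IsBounded Ω)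
    (s : ℝ) (hs : s ∈ Set.Ioo (0 : ℝ) 1)
    (p : FracVarExp.Euc N → FracVarExp.Euc N → ℝ)
    (hp_cont : Continuous (fun z : FracVarExp.Euc N × FracVarExp.Euc N => p z.1 z.2))
    (hp_symm : ∀ x y, p x y = p y x)
    (hp_inf : ∃ a : ℝ, 1 < a ∧ ∀ x y, a ≤ p x y)
    (hp_sup : ∃ b : ℝ, b < (N : ℝ) / s ∧ ∀ x y, p x y ≤ b) :
    0 < FracVarExp.Lambda1 Ω s p ∧
      ∃ u ∈ FracVarExp.X Ω s p \ {0}, 0 ≤ u ∧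
        FracVarExp.rayleigh Ω s p u = FracVarExp.Lambda1 Ω s p := by
  obtain ⟨a, ha1, hap⟩ := hp_inf
  obtain ⟨b, hbN, hpb⟩ := hp_sup
  have ha0 : 0 < a := by linarith
  have hp1 : ∀ x y, 1 ≤ p x y := fun x y => ha1.le.trans (hap x y)
  -- In dimension 0 the bound `N / s` is 0, against `p > 1`.
  have hN : 0 < N := by
    rcases Nat.eq_zero_or_pos N with rfl | h
    · have h1 := hap 0 0
      have h2 := hpb 0 0
      rw [Nat.cast_zero, zero_div] at hbN
      linarith
    · exact h
  have hΩ := hΩ_open.measurableSet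
  have hne := X_sdiff_zero_nonempty (s := s) (p := p) hN hΩ_open hΩ_ne hs ha0 hap
  obtain ⟨w, c, hc0, hc, hw, hw0, hw1, hwc⟩ :=
    exists_minimizing_sequence (s := s) hΩ ha1.le hap hpb hp_cont hne
  obtain ⟨u, hu, hu_nonneg, hu0, hu1, hud⟩ := exists_nonneg_limit hN hΩ hΩ_bdd hs ha1.le hap hpb
    hp_cont hc0 hc hw hw0 hw1 hwc
  have hΛ0 : 0 ≤ Lambda1 Ω s p := ge_of_tendsto' hc fun n => (hc0 n).le
  have hu_ne : ¬ ∀ᵐ x, u x = 0 := by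
    intro h
    rw [lebesgueModular_congr Ω _ (v := fun _ => 0) h] at hu1
    have h0 : ∀ x, (0 : ℝ) ^ p x x = 0 := fun x => Real.zero_rpow (by linarith [hp1 x x])
    simp [lebesgueModular, h0] at hu1
  refine ⟨hΛ0.lt_of_ne fun hΛ => hu_ne ?_, AEEqFun.mk u hu.aestronglyMeasurable, ?_⟩
  · rw [← hΛ] at hud
    exact ae_eq_zero_of_forall_fracModular_le_one hN hΩ hΩ_bdd hs.1.le ha1.le hap hpb hu hu0 hud
  have hsc := fracModular_scaling (s := s) ha0 hap hpb u
  have hlsc := lebesgueModular_scaling Ω ha0 (fun x => hap x x) (fun x => hpb x x) u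
  have hmem : AEEqFun.mk u hu.aestronglyMeasurable ∈ X Ω s p \ {0} := by
    refine ⟨mk_mem_X hu ?_ ?_ hu0, fun h => hu_ne ?_⟩
    · rw [lintegral_eq_setLIntegral_of_ae_eq_zero hΩ]
      · calc _ ≤ ∫⁻ x in Ω, ENNReal.ofReal b * ENNReal.ofReal (|u x| ^ p x x / p x x) := by
              refine lintegral_mono fun x => ?_
              have h1 := hp1 x x
              have h2 := hpb x x
              rw [← ENNReal.ofReal_mul (by linarith)]
              apply ENNReal.ofReal_le_ofReal
              rw [← mul_div_assoc, le_div_iff₀ (by linarith), mul_comm]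
              gcongr
          _ = ENNReal.ofReal b * lebesgueModular Ω (fun x => p x x) u :=
              lintegral_const_mul' _ _ ENNReal.ofReal_ne_top
          _ < ⊤ := by rw [hu1, mul_one]; exact ENNReal.ofReal_lt_top
      · filter_upwards [hu0] with x hx hxΩ
        rw [hx hxΩ, abs_zero, Real.zero_rpow (by linarith [hp1 x x]), ENNReal.ofReal_zero]
    · refine (gagliardo_le_fracModular ha0 hap hpb u).trans_lt ?_
      -- Any scale above `Λ₁` would do: finiteness of the modular at one scale gives it at all.
      have h1 := hsc.ne_top one_pos (d := Lambda1 Ω s p + 1) (by linarith)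
        (ne_top_of_le_ne_top ENNReal.one_ne_top (hud _ (by linarith)))
      simp only [div_one] at h1
      exact (ENNReal.mul_ne_top ENNReal.ofReal_ne_top h1).lt_top
    · rw [Set.mem_singleton_iff, AEEqFun.zero_def, AEEqFun.mk_eq_mk] at h
      exact h
  refine ⟨hmem, ?_, ?_⟩
  · rw [AEEqFun.zero_def, AEEqFun.mk_le_mk]
    exact Filter.Eventually.of_forall hu_nonneg
  · apply le_antisymm
    · have hlux : luxNorm Ω (fun x => p x x) u = 1 := hlsc.sInf_eq_one (by simpa using hu1)
      rw [rayleigh_mk, hlux, div_one]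
      exact hsc.sInf_le_of_forall_le_one hΛ0 hud
    · exact csInf_le ⟨0, by rintro _ ⟨v, -, rfl⟩; exact rayleigh_nonneg v⟩ ⟨_, hmem, rfl⟩
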